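/- Let $\Omega\subset\mathbb R^2$ be a convex polygonal domain, $\|\cdot\|$ the norm of $L^2(\Omega)$, $\|\cdot\|_1$ and $|\cdot|_1$ the norm and semi-norm of $H^1(\Omega)$, and $C_P$ the best constant in Poincaré's inequality $\|w\|\le C_P|w|_1$, $w\in H^1_0(\Omega)$. Let $q\in H^1(\Omega)$ with $0<q_0\le q\le q_1$ a.e., $b=(b_1,b_2)$ with $b_j\in H^1(\Omega)$, $\|b\|_1^2=\|b_1\|_1^2+\|b_2\|_1^2$, $c\in L^\infty(\Omega)$ with $0\le c\le c_1$ a.e., $f,u_0\in L^2(\Omega)$, $T>0$, and let $u\in C([0,T];L^2(\Omega))\cap L^2(0,T;H^1_0(\Omega))$ be a weak solution of $$u_t-\nabla\cdot(q\nabla u)+\nabla\cdot(bu)+cu=f\ \text{ in }(0,T]\times\Omega,\qquad u=0\ \text{ on }[0,T]\times\partial\Omega,\qquad u(0)=u_0 .$$ Let $\mathcal T_h$ be a subdivision of $\Omega$ into finitely many closed convex polygons (e.g. triangles) with disjoint interiors and largest diameter $h$, let $V_h$ be the space of all, or of all continuous, functions that are a polynomial of degree at most $k$ on each element, and let $I_h:L^2(\Omega)\to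 V_h$ be the $L^2(\Omega)$-orthogonal projection. Let $C_A$ be the best constant in $\|I_hw-w\|\le C_Ah|w|_1$, $w\in H^1(\Omega)$. Let $\mu>0$ and $h$ satisfy $$\mu\ \ge\ 2+\frac{4\left((1+C_P)^2\|b\|_1^2+2c_1C_P+|q|_1^2\right)}{q_0},\qquad h^2\le\frac{q_0}{2C_A^2\mu^2}$$ (the second condition is read as $2C_A^2h^2\mu^2\le q_0$). For $\tilde f\in L^2(\Omega)$ let $v_{\tilde f}\in C([0,T];L^2(\Omega))\cap L^2(0,T;H^1_0(\Omega))$ denote a weak solution of the data assimilation equation $$v_t-\nabla\cdot(q\nabla v)+\nabla\cdot(bv)+cv=\tilde f+\mu I_h(u-v)\ \text{ in }(0,T]\times\Omega,\qquad v=0\ \text{ on }[0,T]\times\partial\Omega,\qquad v(0)=0,$$ and let $\nabla_{f,\mathrm{aprox}}J(\tilde f)=-\frac1\mu I_h\big(u(T)-v_{\tilde f}(T)\big)$. Then there is a constant $C>0$, depending only on $\Omega$ and $q_0$ (in particular not on $\mu$, $h$, $k$, $T$, $\tilde f_1$, $\tilde f_2$), such that for all $\tilde f_1,\tilde f_2\in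 L^2(\Omega)$ $$\big\|\nabla_{f,\mathrm{aprox}}J(\tilde f_1)-\nabla_{f,\mathrm{aprox}}J(\tilde f_2)\big\|\le\frac{C}{\mu^{3/2}}\|\tilde f_1-\tilde f_2\| .$$ -/

import Mathlib

open MeasureTheory Set
open scoped ENNReal NNReal ContDiff

noncomputable section

/-- The Euclidean plane. -/
abbrev Plane : Type := EuclideanSpace ℝ (Fin 2)

/-- A convex polygonal domain: the non-empty interior of the convex hull of finitely many points. -/
def IsConvexPolygon (Ω : Set Plane) : Prop :=
  Ω.Nonempty ∧ ∃ s : Finset Plane, Ω = interior (convexHull ℝ (s : Set Plane))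

/-- The Hilbert space `L²(Ω)`. -/
abbrev L2 (Ω : Set Plane) : Type := Lp ℝ 2 ((volume : Measure Plane).restrict Ω)

/-- The space `L^∞(Ω)`. -/
abbrev LInf (Ω : Set Plane) : Type := Lp ℝ ∞ ((volume : Measure Plane).restrict Ω)

/-! ### Sobolev spaces

An element of `H¹(Ω)` is stored together with its weak partial derivatives, as a triple
`(w, ∂₁w, ∂₂w)` in `L²(Ω)³`; the norm of `L²(Ω)³` is then the usual `H¹` norm. -/

/-- Triples `(w, g₁, g₂)` of `L²` functions with the norm `(‖w‖² + ‖g₁‖² + ‖g₂‖²)^{1/2}`. -/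
abbrev Jet (Ω : Set Plane) : Type := PiLp 2 (fun _ : Fin 3 => L2 Ω)

/-- The function `w` of a triple `(w, g₁, g₂)`. -/
def Jet.fn {Ω : Set Plane} (w : Jet Ω) : L2 Ω := w 0

/-- The component `gᵢ` of a triple `(w, g₁, g₂)`. -/
def Jet.pd {Ω : Set Plane} (w : Jet Ω) (i : Fin 2) : L2 Ω := w i.succ

/-- The square `|w|₁² = ‖∂₁w‖² + ‖∂₂w‖²` of the `H¹` semi-norm. -/
def Jet.semiSq {Ω : Set Plane} (w : Jet Ω) : ℝ := ∑ i, ‖w.pd i‖ ^ 2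

/-- The classical partial derivative `∂ᵢφ`. -/
def partialDeriv (i : Fin 2) (φ : Plane → ℝ) (x : Plane) : ℝ :=
  fderiv ℝ φ x (EuclideanSpace.single i 1)

/-- Test functions: `φ ∈ C_c^∞(Ω)`. -/
structure IsTest (Ω : Set Plane) (φ : Plane → ℝ) : Prop where
  smooth : ContDiff ℝ ∞ φ
  compact : HasCompactSupport φ
  support : tsupport φ ⊆ Ω

/-- `g` is the `i`-th weak partial derivative of `w` in `Ω`. -/
def IsWeakPartial {Ω : Set Plane} (i : Fin 2) (w g : L2 Ω) : Prop :=
  ∀ φ : Plane → ℝ, IsTest Ω φ →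
    ∫ x in Ω, w x * partialDeriv i φ x = -∫ x in Ω, g x * φ x

/-- The Sobolev space `H¹(Ω)`. -/
abbrev H1 (Ω : Set Plane) : Type :=
  {w : Jet Ω // ∀ i, IsWeakPartial i w.fn (w.pd i)}

/-- The test functions inside `H¹(Ω)`: triples `(φ, ∂₁φ, ∂₂φ)` with `φ ∈ C_c^∞(Ω)`. -/
def testJets (Ω : Set Plane) : Submodule ℝ (Jet Ω) where
  carrier := {w | ∃ φ : Plane → ℝ, IsTest Ω φ ∧
    (w.fn =ᵐ[volume.restrict Ω] φ) ∧ ∀ i, w.pd i =ᵐ[volume.restrict Ω] partialDeriv i φ}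
  zero_mem' := by
    refine ⟨fun _ => 0, ⟨contDiff_const, HasCompactSupport.zero, ?_⟩, ?_, fun i => ?_⟩
    · have : tsupport (fun _ : Plane => (0 : ℝ)) = ∅ := tsupport_eq_empty_iff.2 rfl
      simp [this]
    · exact Lp.coeFn_zero ℝ 2 _
    · filter_upwards [Lp.coeFn_zero ℝ 2 (volume.restrict Ω)] with x hx
      refine Eq.trans hx ?_
      simp [partialDeriv]
  add_mem' := by
    rintro w w' ⟨φ, hφ, h0, h1⟩ ⟨ψ, hψ, k0, k1⟩
    refine ⟨φ + ψ, ⟨hφ.smooth.add hψ.smooth, hφ.compact.add hψ.compact, ?_⟩, ?_, fun i => ?_⟩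
    · exact (tsupport_add φ ψ).trans (union_subset hφ.support hψ.support)
    · exact (Lp.coeFn_add w.fn w'.fn).trans (h0.add k0)
    · refine (Lp.coeFn_add (w.pd i) (w'.pd i)).trans (((h1 i).add (k1 i)).trans ?_)
      refine Filter.Eventually.of_forall fun x => ?_
      have hd : DifferentiableAt ℝ φ x := (hφ.smooth.differentiable (by simp)) x
      have hd' : DifferentiableAt ℝ ψ x := (hψ.smooth.differentiable (by simp)) x
      simp [partialDeriv, fderiv_add hd hd']
  smul_mem' := by
    rintro a w ⟨φ, hφ, h0, h1⟩
    refine ⟨a • φ, ⟨contDiff_const.smul hφ.smooth, ?_, ?_⟩, ?_, fun i => ?_⟩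
    · exact hφ.compact.smul_left (f := fun _ => a)
    · exact (tsupport_smul_subset_right (fun _ => a) φ).trans hφ.support
    · exact (Lp.coeFn_smul a w.fn).trans (h0.const_smul a)
    · refine (Lp.coeFn_smul a (w.pd i)).trans (((h1 i).const_smul a).trans ?_)
      refine Filter.Eventually.of_forall fun x => ?_
      have hd : DifferentiableAt ℝ φ x := (hφ.smooth.differentiable (by simp)) x
      simp [partialDeriv, fderiv_const_smul hd]

/-- The Sobolev space `H¹₀(Ω)`: the closure of `C_c^∞(Ω)` in the `H¹` norm. -/
def H10 (Ω : Set Plane) : Submodule ℝ (Jet Ω) := (testJets Ω).topologicalClosure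

/-- The best constant `C_P` in Poincaré's inequality `‖w‖ ≤ C_P |w|₁`, `w ∈ H¹₀(Ω)`
(by convention `∞` if there were no such constant). -/
def poincareConst (Ω : Set Plane) : ℝ≥0∞ :=
  ⨅ (C : ℝ≥0) (_ : ∀ w ∈ H10 Ω, ‖w.fn‖ ≤ C * Real.sqrt w.semiSq), (C : ℝ≥0∞)

/-! ### Subdivisions, finite element spaces and the `L²` projection -/

/-- A subdivision of `Ω` into finitely many closed convex polygons (for instance triangles) with
disjoint interiors. -/
structure Subdivision (Ω : Set Plane) where
  elements : Finset (Set Plane)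
  polygon : ∀ T ∈ elements, ∃ s : Finset Plane, T = convexHull ℝ (s : Set Plane)
  solid : ∀ T ∈ elements, (interior T).Nonempty
  disjoint : ∀ T ∈ elements, ∀ T' ∈ elements, T ≠ T' → Disjoint (interior T) (interior T')
  cover : ⋃ T ∈ elements, T = closure Ω

/-- The mesh size `h`: the largest diameter of an element. -/
def Subdivision.meshSize {Ω : Set Plane} (𝒯 : Subdivision Ω) : ℝ≥0 :=
  𝒯.elements.sup fun T => (Metric.diam T).toNNReal

/-- The value at `x` of a polynomial in two variables. -/
def polyVal (p : MvPolynomial (Fin 2) ℝ) (x : Plane) : ℝ := MvPolynomial.eval (fun i => x i) p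

theorem polyVal_zero (x : Plane) : polyVal 0 x = 0 := map_zero _

theorem polyVal_add (p p' : MvPolynomial (Fin 2) ℝ) (x : Plane) :
    polyVal (p + p') x = polyVal p x + polyVal p' x := map_add _ _ _

theorem polyVal_smul (a : ℝ) (p : MvPolynomial (Fin 2) ℝ) (x : Plane) :
    polyVal (a • p) x = a * polyVal p x := MvPolynomial.smul_eval _ _ _

/-- Functions in `L²(Ω)` that are a polynomial of degree at most `k` on each element. -/
def piecewisePoly {Ω : Set Plane} (𝒯 : Subdivision Ω) (k : ℕ) : Submodule ℝ (L2 Ω) where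
  carrier := {g | ∀ T ∈ 𝒯.elements, ∃ p ∈ MvPolynomial.restrictTotalDegree (Fin 2) ℝ k,
    ∀ᵐ x ∂(volume : Measure Plane).restrict Ω, x ∈ T → g x = polyVal p x}
  zero_mem' := by
    intro T _
    refine ⟨0, zero_mem _, ?_⟩
    filter_upwards [Lp.coeFn_zero ℝ 2 (volume.restrict Ω)] with x hx _
    rw [hx, polyVal_zero]; rfl
  add_mem' := by
    intro g g' hg hg' T hT
    obtain ⟨p, hp, h⟩ := hg T hT
    obtain ⟨p', hp', h'⟩ := hg' T hT
    refine ⟨p + p', add_mem hp hp', ?_⟩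
    filter_upwards [Lp.coeFn_add g g', h, h'] with x hx h1 h2 hT
    rw [hx, Pi.add_apply, h1 hT, h2 hT, polyVal_add]
  smul_mem' := by
    intro a g hg T hT
    obtain ⟨p, hp, h⟩ := hg T hT
    refine ⟨a • p, Submodule.smul_mem _ _ hp, ?_⟩
    filter_upwards [Lp.coeFn_smul a g, h] with x hx h1 hT
    rw [hx, Pi.smul_apply, h1 hT, polyVal_smul, smul_eq_mul]

/-- Functions in `L²(Ω)` that are continuous on the closure of `Ω`
(after a change on a null set). -/
def continuousFns (Ω : Set Plane) : Submodule ℝ (L2 Ω) where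
  carrier := {g | ∃ G : Plane → ℝ, ContinuousOn G (closure Ω) ∧ g =ᵐ[volume.restrict Ω] G}
  zero_mem' := ⟨0, continuousOn_const, Lp.coeFn_zero ℝ 2 _⟩
  add_mem' := by
    rintro g g' ⟨G, hG, h⟩ ⟨G', hG', h'⟩
    exact ⟨G + G', hG.add hG', (Lp.coeFn_add g g').trans (h.add h')⟩
  smul_mem' := by
    rintro a g ⟨G, hG, h⟩
    exact ⟨a • G, hG.const_smul a, (Lp.coeFn_smul a g).trans (h.const_smul a)⟩

/-- The two usual kinds of piecewise polynomial spaces: without or with continuity across the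
element boundaries. -/
inductive ElementKind where
  | discontinuous
  | continuous

/-- The finite element space `V_h = 𝒫_k(𝒯)`. -/
def feSpace {Ω : Set Plane} (𝒯 : Subdivision Ω) (k : ℕ) : ElementKind → Submodule ℝ (L2 Ω)
  | .discontinuous => piecewisePoly 𝒯 k
  | .continuous => piecewisePoly 𝒯 k ⊓ continuousFns Ω

theorem finiteDimensional_piecewisePoly {Ω : Set Plane} (𝒯 : Subdivision Ω) (k : ℕ) :
    FiniteDimensional ℝ (piecewisePoly 𝒯 k) := by
  let E := 𝒯.elements → MvPolynomial.restrictTotalDegree (Fin 2) ℝ k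
  let R : Submodule ℝ (L2 Ω × E) :=
    { carrier := {z | ∀ T : 𝒯.elements, ∀ᵐ x ∂(volume : Measure Plane).restrict Ω,
        x ∈ T.1 → z.1 x = polyVal (z.2 T).1 x}
      zero_mem' := by
        intro T
        filter_upwards [Lp.coeFn_zero ℝ 2 (volume.restrict Ω)] with x hx _
        exact hx.trans (polyVal_zero x).symm
      add_mem' := by
        intro z z' hz hz' T
        filter_upwards [Lp.coeFn_add z.1 z'.1, hz T, hz' T] with x hx h1 h2 hT
        exact hx.trans ((congrArg₂ _ (h1 hT) (h2 hT)).trans (polyVal_add _ _ x).symm)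
      smul_mem' := by
        intro a z hz T
        filter_upwards [Lp.coeFn_smul a z.1, hz T] with x hx h1 hT
        exact hx.trans ((congrArg (a * ·) (h1 hT)).trans (polyVal_smul a _ x).symm) }
  have hinj : Function.Injective ((LinearMap.snd ℝ (L2 Ω) E).comp R.subtype) := by
    refine (injective_iff_map_eq_zero _).2 ?_
    rintro ⟨⟨g, p⟩, hz⟩ hp
    have hp' : p = 0 := hp
    subst hp'
    have hall : ∀ᵐ x ∂(volume : Measure Plane).restrict Ω,
        ∀ T : 𝒯.elements, x ∈ T.1 → g x = 0 := by
      refine MeasureTheory.ae_all_iff.2 fun T => ?_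
      filter_upwards [hz T] with x hx hT
      exact (hx hT).trans (polyVal_zero x)
    have hcov : ∀ᵐ x ∂(volume : Measure Plane).restrict Ω, x ∈ closure Ω :=
      (ae_restrict_mem isClosed_closure.measurableSet).filter_mono
        (ae_mono (Measure.restrict_mono subset_closure le_rfl))
    have hg : g = 0 := by
      refine Lp.ext ?_
      filter_upwards [hall, hcov, Lp.coeFn_zero ℝ 2 (volume.restrict Ω)] with x h1 h2 h3
      rw [← 𝒯.cover] at h2
      obtain ⟨T, hT, hx⟩ := mem_iUnion₂.1 h2
      rw [h1 ⟨T, hT⟩ hx, h3]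
      rfl
    simp [hg]
  have hR : FiniteDimensional ℝ R := FiniteDimensional.of_injective _ hinj
  have hmap : piecewisePoly 𝒯 k ≤ R.map (LinearMap.fst ℝ (L2 Ω) E) := by
    intro g hg
    choose p hp h using hg
    exact ⟨(g, fun T => ⟨p T.1 T.2, hp T.1 T.2⟩), fun T => h T.1 T.2, rfl⟩
  exact Submodule.finiteDimensional_of_le hmap

instance finiteDimensional_feSpace {Ω : Set Plane} (𝒯 : Subdivision Ω) (k : ℕ)
    (κ : ElementKind) : FiniteDimensional ℝ (feSpace 𝒯 k κ) := by
  have := finiteDimensional_piecewisePoly 𝒯 k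
  cases κ
  · exact this
  · exact Submodule.finiteDimensional_of_le inf_le_left

/-- The `L²(Ω)`-orthogonal projection `I_h` onto `V_h`. -/
def projFE {Ω : Set Plane} (𝒯 : Subdivision Ω) (k : ℕ) (κ : ElementKind) : L2 Ω →L[ℝ] L2 Ω :=
  (feSpace 𝒯 k κ).starProjection

/-- The best constant `C_A` in the approximation property `‖I_h w - w‖ ≤ C_A h |w|₁`, `w ∈ H¹(Ω)`
(by convention `∞` if there were no such constant). -/
def approxConst {Ω : Set Plane} (𝒯 : Subdivision Ω) (k : ℕ) (κ : ElementKind) : ℝ≥0∞ :=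
  ⨅ (C : ℝ≥0) (_ : ∀ w : H1 Ω, ‖projFE 𝒯 k κ w.1.fn - w.1.fn‖
      ≤ C * 𝒯.meshSize * Real.sqrt w.1.semiSq), (C : ℝ≥0∞)

/-! ### The parabolic equation and the approximated gradient -/

/-- The bilinear form `∫_Ω q ∇v·∇φ - v b·∇φ + c v φ` of
`v ↦ -∇·(q∇v) + ∇·(b v) + c v`. -/
def energyForm {Ω : Set Plane} (q : H1 Ω) (b : Fin 2 → H1 Ω) (c : LInf Ω) (v φ : Jet Ω) : ℝ :=
  ∫ x in Ω, ((∑ i, q.1.fn x * v.pd i x * φ.pd i x)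
    - (∑ i, v.fn x * (b i).1.fn x * φ.pd i x) + c x * v.fn x * φ.fn x)

/-- `v ∈ C([0,T]; L²(Ω)) ∩ L²(0,T; H¹₀(Ω))` is the weak solution of
`v_t - ∇·(q∇v) + ∇·(b v) + c v = F` in `(0,T] × Ω`, `v = 0` on `[0,T] × ∂Ω`, `v(0) = v₀`.
The equation is tested with `φ ∈ H¹₀(Ω)` and integrated in time; since
`F - (-∇·(q∇v) + ∇·(b v) + c v)` is in `L²(0,T; H⁻¹(Ω))`, this says that it is the weak time
derivative of `v`. -/
structure IsWeakSolution {Ω : Set Plane} (T : ℝ) (q : H1 Ω) (b : Fin 2 → H1 Ω) (c : LInf Ω)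
    (F : ℝ → L2 Ω) (v₀ : L2 Ω) (v : ℝ → L2 Ω) : Prop where
  continuousOn : ContinuousOn v (Icc 0 T)
  initial : v 0 = v₀
  weak : ∃ V : ℝ → H10 Ω, MemLp V 2 (volume.restrict (Icc 0 T)) ∧
    (∀ᵐ t ∂volume.restrict (Icc 0 T), (V t).1.fn = v t) ∧
    ∀ φ : H10 Ω, ∀ t ∈ Icc 0 T,
      inner ℝ (v t) φ.1.fn - inner ℝ v₀ φ.1.fn + ∫ s in (0 : ℝ)..t, energyForm q b c (V s).1 φ.1
        = ∫ s in (0 : ℝ)..t, inner ℝ (F s) φ.1.fn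

/-- `v` is the solution `v_{f̃}` of the continuous data assimilation equation
`v_t - ∇·(q∇v) + ∇·(b v) + c v = f̃ + μ I_h (u - v)`, `v(0) = 0`, `v = 0` on the boundary. -/
def IsAssimilated {Ω : Set Plane} (T : ℝ) (q : H1 Ω) (b : Fin 2 → H1 Ω) (c : LInf Ω)
    (𝒯 : Subdivision Ω) (k : ℕ) (κ : ElementKind) (μ : ℝ) (u : ℝ → L2 Ω) (f : L2 Ω)
    (v : ℝ → L2 Ω) : Prop :=
  IsWeakSolution T q b c (fun t => f + μ • projFE 𝒯 k κ (u t - v t)) 0 v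

/-- The approximated gradient `-(1/μ) I_h (u - v)` at time `t = T`, where `v = v_{f̃}`. -/
def approxGradF {Ω : Set Plane} (𝒯 : Subdivision Ω) (k : ℕ) (κ : ElementKind) (μ T : ℝ)
    (u v : ℝ → L2 Ω) : L2 Ω :=
  -((1 / μ) • projFE 𝒯 k κ (u T - v T))

end

noncomputable section

variable {Ω : Set Plane}

/-! The difference `w = v₁ - v₂` starts from zero, does not contain `u`, and solves `w_t + A w + μ
I_h w = f₁ - f₂`, where `A` is the elliptic operator. Testing with `w` gives a dissipative
inequality for `‖w‖²`. Orthogonality of `I_h` turns the nudging term into `μ (‖w‖² - ‖I_h w - w‖²)`,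
and the mesh condition bounds `μ ‖I_h w - w‖²` by `q₀ |w|₁² / 4`. The convection term is absorbed by
diffusion and nudging, and what remains is `⟨w_t, w⟩ ≤ -(μ/4) (‖w‖² - 4 ‖f₁ - f₂‖² / μ²)`. Hence
`‖w(T)‖ ≤ 2 ‖f₁ - f₂‖ / μ`. The factor `1/μ` of the gradient gives `2/μ²`, which is at most
`2/μ^{3/2}` because `μ ≥ 1`.

Two points need work. The coefficients `bᵢ` are only in `H¹(Ω)`. That `bᵢ v` lies in `L²(Ω)` for `v
∈ H¹₀(Ω)` comes from the planar embedding of `W^{1,1}` in `L²` applied to the product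
(`eLpNorm_mul_le_of_mem_H10`). The convection term is integrated by parts to `-½ ∫ (div b) v²` and
bounded by Ladyzhenskaya's inequality (`abs_convection_le`).

Moreover `w` has only a weak time derivative. The equation is linear and autonomous, so the moving
averages `h⁻¹ ∫_t^{t+h} w` solve it pointwise in time and are differentiable; the estimate is proved
for them and `h → 0` (`norm_sq_le_of_weak_evolution`). -/

/-! ### Gagliardo–Nirenberg inequality in the plane -/

/-- The dual of the sup norm is the `ℓ¹` norm; this converts an operator norm on `Fin 2 → ℝ` into
partial derivatives. -/
theorem enorm_le_sum_enorm_single (L : (Fin 2 → ℝ) →L[ℝ] ℝ) :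
    ‖L‖ₑ ≤ ∑ i, ‖L (Pi.single i 1)‖ₑ := by
  have h : ‖L‖ ≤ ∑ i, ‖L (Pi.single i 1)‖ := by
    refine L.opNorm_le_bound (by positivity) fun v => ?_
    have hv : L v = ∑ i, v i * L (Pi.single i 1) := by
      conv_lhs => rw [← Finset.univ_sum_single v, map_sum]
      refine Finset.sum_congr rfl fun i _ => ?_
      have : Pi.single i (v i) = v i • (Pi.single i 1 : Fin 2 → ℝ) := by
        rw [← Pi.single_smul, smul_eq_mul, mul_one]
      rw [this, map_smul, smul_eq_mul]
    rw [hv, Finset.sum_mul]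
    refine (norm_sum_le _ _).trans (Finset.sum_le_sum fun i _ => ?_)
    rw [norm_mul, mul_comm]
    gcongr
    exact norm_le_pi_norm v i
  have := ENNReal.ofReal_le_ofReal h
  rw [ENNReal.ofReal_sum_of_nonneg fun _ _ => norm_nonneg _] at this
  simpa only [ofReal_norm] using this

/-- The Gagliardo–Nirenberg inequality `‖u‖_{L²} ≤ ‖∇u‖_{L¹}` in the plane. -/
theorem lintegral_sq_le_sq_lintegral_partialDeriv {u : Plane → ℝ} (hu : ContDiff ℝ 1 u)
    (hc : HasCompactSupport u) :
    ∫⁻ x, ‖u x‖ₑ ^ 2 ≤ (∫⁻ x, ∑ i, ‖partialDeriv i u x‖ₑ) ^ 2 := by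
  let e := (EuclideanSpace.equiv (Fin 2) ℝ).symm
  have hmp : MeasurePreserving (fun y : Fin 2 → ℝ => e y) volume volume :=
    PiLp.volume_preserving_toLp (Fin 2)
  have hme : MeasurableEmbedding (fun y : Fin 2 → ℝ => e y) :=
    e.toHomeomorph.measurableEmbedding
  -- The exponent `2` on the left is the conjugate of the dimension.
  have hp : Real.HolderConjugate ((Fintype.card (Fin 2) : ℕ) : ℝ) 2 := by
    simpa using Real.HolderConjugate.two_two
  have key := lintegral_pow_le_pow_lintegral_fderiv_aux hp (u := u ∘ e)
    (hu.comp e.contDiff) (hc.comp_homeomorph e.toHomeomorph)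
  have hd (y : Fin 2 → ℝ) : ‖fderiv ℝ (u ∘ e) y‖ₑ ≤ ∑ i, ‖partialDeriv i u (e y)‖ₑ := by
    refine (enorm_le_sum_enorm_single _).trans_eq (Finset.sum_congr rfl fun i _ => ?_)
    rw [fderiv_comp _ (hu.differentiable one_ne_zero _) e.differentiableAt, e.fderiv]
    rfl
  rw [← hmp.lintegral_comp_emb hme, ← hmp.lintegral_comp_emb hme]
  have h2 : ∀ a : ℝ≥0∞, a ^ (2 : ℝ) = a ^ 2 := fun a => by
    rw [← ENNReal.rpow_natCast]; norm_num
  simp only [h2] at key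
  exact key.trans (pow_le_pow_left₀ zero_le (lintegral_mono hd) 2)

/-- Young's inequality: by Tonelli, averaging against a kernel of mass one does not increase the
`L¹` norm. -/
theorem lintegral_enorm_convolution_le {η G : Plane → ℝ} (hη : Continuous η)
    (hη0 : ∀ x, 0 ≤ η x) (hη1 : ∫ x, η x = 1) (hi : Integrable η)
    (hG : AEStronglyMeasurable G) :
    ∫⁻ x, ‖∫ y, η (x - y) * G y‖ₑ ≤ ∫⁻ x, ‖G x‖ₑ := by
  have hone : ∫⁻ x, ‖η x‖ₑ = 1 := by
    have := ofReal_integral_eq_lintegral_ofReal hi (Filter.Eventually.of_forall hη0)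
    rw [hη1, ENNReal.ofReal_one] at this
    rw [this]
    exact lintegral_congr fun x => Real.enorm_of_nonneg (hη0 x)
  calc ∫⁻ x, ‖∫ y, η (x - y) * G y‖ₑ
      ≤ ∫⁻ x, ∫⁻ y, ‖η (x - y)‖ₑ * ‖G y‖ₑ := by
        refine lintegral_mono fun x => (enorm_integral_le_lintegral_enorm _).trans_eq ?_
        simp only [enorm_mul]
    _ = ∫⁻ y, ∫⁻ x, ‖η (x - y)‖ₑ * ‖G y‖ₑ := by
        have h1 : AEMeasurable (fun z : Plane × Plane => ‖η (z.1 - z.2)‖ₑ) (volume.prod volume) :=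
          (hη.comp (continuous_fst.sub continuous_snd)).enorm.measurable.aemeasurable
        have h2 : AEMeasurable (fun z : Plane × Plane => ‖G z.2‖ₑ) (volume.prod volume) :=
          hG.enorm.comp_quasiMeasurePreserving Measure.quasiMeasurePreserving_snd
        exact lintegral_lintegral_swap (h1.mul h2)
    _ = ∫⁻ y, ‖G y‖ₑ := by
        refine lintegral_congr fun y => ?_
        have h1 : Measurable fun x => ‖η (x - y)‖ₑ :=
          (hη.comp (continuous_id.sub continuous_const)).enorm.measurable
        rw [lintegral_mul_const _ h1,
          lintegral_sub_right_eq_self (fun x => ‖η x‖ₑ) y, hone, one_mul]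

/-- The derivative of a mollified function is the mollified weak derivative. -/
theorem partialDeriv_convolution {η g G : Plane → ℝ} {i : Fin 2} (hη : ContDiff ℝ ∞ η)
    (hηc : HasCompactSupport η) (hg : LocallyIntegrable g)
    (hw : ∀ ψ : Plane → ℝ, ContDiff ℝ ∞ ψ → HasCompactSupport ψ →
      ∫ x, g x * partialDeriv i ψ x = -∫ x, G x * ψ x) (x : Plane) :
    partialDeriv i (convolution η g (ContinuousLinearMap.lsmul ℝ ℝ) volume) x
      = ∫ y, η (x - y) * G y := by
  have hη1 : ContDiff ℝ 1 η := hη.of_le (by simp)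
  have h1 := hηc.hasFDerivAt_convolution_right (ContinuousLinearMap.lsmul ℝ ℝ).flip hg hη1 x
  rw [convolution_flip] at h1
  rw [partialDeriv, h1.fderiv, convolution_precompR_apply _ hg (hηc.fderiv ℝ)
    (hη1.continuous_fderiv one_ne_zero)]
  -- The reflected kernel is the test function; its inner derivative `-1` cancels the sign of the
  -- weak derivative.
  have h2 := hw (fun y => η (x - y)) (hη.comp (contDiff_const.sub contDiff_id))
    (hηc.comp_homeomorph (Homeomorph.subLeft x))
  have h3 (y : Plane) : partialDeriv i (fun y => η (x - y)) y
      = -(fderiv ℝ η (x - y) (EuclideanSpace.single i 1)) := by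
    have h4 : HasFDerivAt (fun y => η (x - y))
        ((fderiv ℝ η (x - y)).comp (-ContinuousLinearMap.id ℝ Plane)) y := by
      refine (hη.differentiable (by simp) (x - y)).hasFDerivAt.comp y ?_
      exact (hasFDerivAt_id y).const_sub x
    rw [partialDeriv, h4.fderiv]
    simp
  simp only [h3, mul_neg, integral_neg, neg_inj] at h2
  rw [convolution_def]
  refine Eq.trans (integral_congr_ae (Filter.Eventually.of_forall fun y => ?_))
    (h2.trans (integral_congr_ae (Filter.Eventually.of_forall fun y => mul_comm _ _)))
  exact mul_comm _ _

/-- The Gagliardo–Nirenberg inequality for compactly supported functions with weak derivatives. -/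
theorem lintegral_sq_le_of_weakPartial {g : Plane → ℝ} {G : Fin 2 → Plane → ℝ}
    (hg : LocallyIntegrable g) (hc : HasCompactSupport g)
    (hG : ∀ i, AEStronglyMeasurable (G i))
    (hw : ∀ i (ψ : Plane → ℝ), ContDiff ℝ ∞ ψ → HasCompactSupport ψ →
      ∫ x, g x * partialDeriv i ψ x = -∫ x, G i x * ψ x) :
    ∫⁻ x, ‖g x‖ₑ ^ 2 ≤ (∑ i, ∫⁻ x, ‖G i x‖ₑ) ^ 2 := by
  -- The radii shrink with fixed ratio 2, as required for a.e. convergence of the mollifications of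
  -- a locally integrable function.
  let φ : ℕ → ContDiffBump (0 : Plane) := fun n =>
    ⟨1 / (n + 1 : ℝ), 2 * (1 / (n + 1 : ℝ)), by positivity, by
      have : (0 : ℝ) < 1 / (n + 1 : ℝ) := by positivity
      linarith⟩
  let η : ℕ → Plane → ℝ := fun n => (φ n).normed volume
  have hηs (n) : ContDiff ℝ ∞ (η n) := (φ n).contDiff_normed
  have hηc (n) : HasCompactSupport (η n) := (φ n).hasCompactSupport_normed
  let u : ℕ → Plane → ℝ := fun n =>
    convolution (η n) g (ContinuousLinearMap.lsmul ℝ ℝ) volume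
  have hus (n) : ContDiff ℝ 1 (u n) :=
    (hηc n).contDiff_convolution_left _ ((hηs n).of_le (by simp)) hg
  have huc (n) : HasCompactSupport (u n) := (hηc n).convolution _ hc
  have hd (n i x) : partialDeriv i (u n) x = ∫ y, η n (x - y) * G i y :=
    partialDeriv_convolution (hηs n) (hηc n) hg (hw i) x
  have hb (n) : ∫⁻ x, ‖u n x‖ₑ ^ 2 ≤ (∑ i, ∫⁻ x, ‖G i x‖ₑ) ^ 2 := by
    refine (lintegral_sq_le_sq_lintegral_partialDeriv (hus n) (huc n)).trans ?_
    have hm (i) : Measurable fun x => ‖partialDeriv i (u n) x‖ₑ :=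
      (((hus n).continuous_fderiv one_ne_zero).clm_apply continuous_const).enorm.measurable
    rw [lintegral_finsetSum _ fun i _ => hm i]
    refine pow_le_pow_left₀ zero_le (Finset.sum_le_sum fun i _ => ?_) 2
    simp only [hd]
    exact lintegral_enorm_convolution_le (hηs n).continuous (φ n).nonneg_normed
      (φ n).integral_normed (φ n).integrable_normed (hG i)
  have hlim : ∀ᵐ x, Filter.Tendsto (fun n => u n x) Filter.atTop (nhds (g x)) := by
    refine ContDiffBump.ae_convolution_tendsto_right_of_locallyIntegrable (K := 2) ?_ ?_ hg
    · simpa [φ] using (tendsto_one_div_add_atTop_nhds_zero_nat (𝕜 := ℝ)).const_mul 2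
    · exact Filter.Eventually.of_forall fun n => le_rfl
  -- Fatou's lemma carries the uniform bound to the a.e. limit.
  calc ∫⁻ x, ‖g x‖ₑ ^ 2 = ∫⁻ x, Filter.liminf (fun n => ‖u n x‖ₑ ^ 2) Filter.atTop := by
        refine lintegral_congr_ae ?_
        filter_upwards [hlim] with x hx
        exact (((ENNReal.continuous_pow 2).tendsto _).comp hx.enorm).liminf_eq.symm
    _ ≤ Filter.liminf (fun n => ∫⁻ x, ‖u n x‖ₑ ^ 2) Filter.atTop :=
        lintegral_liminf_le fun n => (hus n).continuous.enorm.measurable.pow_const 2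
    _ ≤ _ := Filter.liminf_le_of_le (by isBoundedDefault) fun b hb' =>
        let ⟨n, hn⟩ := hb'.exists
        hn.trans (hb n)

/-! ### Norms of jets and properties of test functions -/

theorem sq_eLpNorm_two {α : Type*} [MeasurableSpace α] {ν : Measure α} (f : α → ℝ) :
    eLpNorm f 2 ν ^ 2 = ∫⁻ x, ‖f x‖ₑ ^ 2 ∂ν := by
  have := eLpNorm_nnreal_pow_eq_lintegral (f := f) (μ := ν) (p := 2) two_ne_zero
  simpa using this

theorem lintegral_enorm_mul_le {α : Type*} [MeasurableSpace α] {ν : Measure α}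
    (f g : Lp ℝ 2 ν) : ∫⁻ x, ‖f x * g x‖ₑ ∂ν ≤ ‖f‖ₑ * ‖g‖ₑ := by
  rw [Lp.enorm_def, Lp.enorm_def]
  have := eLpNorm_smul_le_mul_eLpNorm (p := 2) (q := 2) (r := 1)
    (Lp.aestronglyMeasurable g) (Lp.aestronglyMeasurable f)
  rwa [eLpNorm_one_eq_lintegral_enorm] at this

theorem Jet.norm_fn_le (w : Jet Ω) : ‖w.fn‖ ≤ ‖w‖ := PiLp.norm_apply_le w 0

theorem Jet.norm_pd_le (w : Jet Ω) (i : Fin 2) : ‖w.pd i‖ ≤ ‖w‖ := PiLp.norm_apply_le w i.succ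

theorem Jet.semiSq_nonneg (w : Jet Ω) : 0 ≤ w.semiSq :=
  Finset.sum_nonneg fun _ _ => sq_nonneg _

namespace IsTest

variable {φ : Plane → ℝ}

theorem continuous_partialDeriv (hφ : IsTest Ω φ) (i : Fin 2) : Continuous (partialDeriv i φ) :=
  (hφ.smooth.continuous_fderiv (by simp)).clm_apply continuous_const

theorem tsupport_partialDeriv_subset (i : Fin 2) :
    tsupport (partialDeriv i φ) ⊆ tsupport φ := by
  refine closure_minimal (fun x hx => ?_) isClosed_closure
  refine tsupport_fderiv_subset ℝ (subset_tsupport _ fun h => hx ?_)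
  simp [partialDeriv, h]

theorem hasCompactSupport_partialDeriv (hφ : IsTest Ω φ) (i : Fin 2) :
    HasCompactSupport (partialDeriv i φ) :=
  hφ.compact.of_isClosed_subset isClosed_closure (tsupport_partialDeriv_subset i)

theorem eq_zero (hφ : IsTest Ω φ) {x : Plane} (hx : x ∉ Ω) : φ x = 0 :=
  image_eq_zero_of_notMem_tsupport fun h => hx (hφ.support h)

theorem partialDeriv_eq_zero (hφ : IsTest Ω φ) (i : Fin 2) {x : Plane} (hx : x ∉ Ω) :
    partialDeriv i φ x = 0 :=
  image_eq_zero_of_notMem_tsupport fun h => hx (hφ.support (tsupport_partialDeriv_subset i h))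

theorem mul_smooth (hφ : IsTest Ω φ) {ψ : Plane → ℝ} (hψ : ContDiff ℝ ∞ ψ) :
    IsTest Ω fun x => φ x * ψ x where
  smooth := hφ.smooth.mul hψ
  compact := hφ.compact.mul_right
  support := (tsupport_mul_subset_left).trans hφ.support

theorem memLp (hφ : IsTest Ω φ) : MemLp φ 2 (volume.restrict Ω) :=
  (hφ.smooth.continuous.memLp_of_hasCompactSupport hφ.compact).restrict Ω

theorem memLp_partialDeriv (hφ : IsTest Ω φ) (i : Fin 2) :
    MemLp (partialDeriv i φ) 2 (volume.restrict Ω) :=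
  ((hφ.continuous_partialDeriv i).memLp_of_hasCompactSupport
    (hφ.hasCompactSupport_partialDeriv i)).restrict Ω

end IsTest

/-! ### Products of `H¹(Ω)` and `H¹₀(Ω)` functions -/

theorem partialDeriv_mul (i : Fin 2) {φ ψ : Plane → ℝ} {x : Plane}
    (hφ : DifferentiableAt ℝ φ x) (hψ : DifferentiableAt ℝ ψ x) :
    partialDeriv i (fun x => φ x * ψ x) x
      = φ x * partialDeriv i ψ x + ψ x * partialDeriv i φ x := by
  simp [partialDeriv, fderiv_fun_mul hφ hψ]

theorem setIntegral_mul_test {φ : Plane → ℝ} (h : ∀ x ∉ Ω, φ x = 0) (f : Plane → ℝ) :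
    ∫ x in Ω, f x * φ x = ∫ x, f x * φ x :=
  setIntegral_eq_integral_of_forall_compl_eq_zero fun x hx => by rw [h x hx, mul_zero]

/-- The product rule for a weakly differentiable function and a test function. -/
theorem IsWeakPartial.mul_test {i : Fin 2} {w g : L2 Ω} (hw : IsWeakPartial i w g)
    {φ : Plane → ℝ} (hφ : IsTest Ω φ) {ψ : Plane → ℝ} (hψ : ContDiff ℝ ∞ ψ)
    (hψc : HasCompactSupport ψ) :
    ∫ x, (w x * φ x) * partialDeriv i ψ x
      = -∫ x, (g x * φ x + w x * partialDeriv i φ x) * ψ x := by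
  have hψ' : IsTest univ ψ := ⟨hψ, hψc, subset_univ _⟩
  have key := hw _ (hφ.mul_smooth hψ)
  have hbd {f : Plane → ℝ} (hf : Continuous f) (hc : HasCompactSupport f) :
      MemLp f 2 ((volume : Measure Plane).restrict Ω) :=
    (hf.memLp_of_hasCompactSupport hc).restrict Ω
  have hI1 : Integrable (fun x => w x * (φ x * partialDeriv i ψ x)) (volume.restrict Ω) :=
    (Lp.memLp w).integrable_mul (hbd (hφ.smooth.continuous.mul (hψ'.continuous_partialDeriv i))
      hφ.compact.mul_right)
  have hI2 : Integrable (fun x => w x * (ψ x * partialDeriv i φ x)) (volume.restrict Ω) :=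
    (Lp.memLp w).integrable_mul (hbd (hψ.continuous.mul (hφ.continuous_partialDeriv i))
      hψc.mul_right)
  have hI3 : Integrable (fun x => g x * (φ x * ψ x)) (volume.restrict Ω) :=
    (Lp.memLp g).integrable_mul (hbd (hφ.smooth.continuous.mul hψ.continuous)
      hφ.compact.mul_right)
  have h1 : ∫ x, (w x * φ x) * partialDeriv i ψ x
      = ∫ x in Ω, w x * (φ x * partialDeriv i ψ x) := by
    rw [setIntegral_mul_test fun x hx => by rw [hφ.eq_zero hx, zero_mul]]
    simp only [mul_assoc]
  have h2 : ∫ x, (g x * φ x + w x * partialDeriv i φ x) * ψ x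
      = ∫ x in Ω, (g x * (φ x * ψ x) + w x * (ψ x * partialDeriv i φ x)) := by
    rw [setIntegral_eq_integral_of_forall_compl_eq_zero fun x hx => by
      rw [hφ.eq_zero hx, hφ.partialDeriv_eq_zero i hx]; ring]
    exact integral_congr_ae (Filter.Eventually.of_forall fun x => by ring)
  have h3 : ∫ x in Ω, w x * partialDeriv i (fun x => φ x * ψ x) x
      = ∫ x in Ω, (w x * (φ x * partialDeriv i ψ x) + w x * (ψ x * partialDeriv i φ x)) := by
    refine integral_congr_ae (Filter.Eventually.of_forall fun x => ?_)
    simp only [partialDeriv_mul i (hφ.smooth.differentiable (by simp) x)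
      (hψ.differentiable (by simp) x), mul_add]
  rw [h3, integral_add hI1 hI2] at key
  rw [h1, h2, integral_add hI3 hI2]
  linarith

/-- The gradient of `b φ` consists of products of two `L²` functions, hence is in `L¹`, and
Gagliardo–Nirenberg applies. The constant 4 counts two partial derivatives with two product-rule
terms each. -/
theorem eLpNorm_mul_le_of_mem_testJets (hΩ : IsOpen Ω) (b : H1 Ω) {v : Jet Ω}
    (hv : v ∈ testJets Ω) :
    eLpNorm (fun x => b.1.fn x * v.fn x) 2 (volume.restrict Ω) ≤ 4 * ‖b.1‖ₑ * ‖v‖ₑ := by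
  obtain ⟨φ, hφ, h0, h1⟩ := hv
  have hΩm : MeasurableSet Ω := hΩ.measurableSet
  -- The representative of a class on `Ω` is measurable on the whole plane; its values outside `Ω`
  -- are always multiplied by zero.
  have hsm (f : L2 Ω) : AEStronglyMeasurable f (volume : Measure Plane) :=
    (Lp.stronglyMeasurable f).aestronglyMeasurable
  have hG := lintegral_sq_le_of_weakPartial (g := fun x => b.1.fn x * φ x)
    (G := fun i x => b.1.pd i x * φ x + b.1.fn x * partialDeriv i φ x) ?_ hφ.compact.mul_left
    (fun i => ?_) fun i ψ hψ hψc => (b.2 i).mul_test hφ hψ hψc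
  · have hi (i : Fin 2) : ∫⁻ x, ‖b.1.pd i x * φ x + b.1.fn x * partialDeriv i φ x‖ₑ
        ≤ 2 * ‖b.1‖ₑ * ‖v‖ₑ := by
      rw [← setLIntegral_eq_of_support_subset (s := Ω)]
      · calc _ ≤ ∫⁻ x in Ω, (‖b.1.pd i x * v.fn x‖ₑ + ‖b.1.fn x * v.pd i x‖ₑ) := by
              refine lintegral_mono_ae ?_
              filter_upwards [h0, h1 i] with x hx hx'
              rw [← hx, ← hx']
              exact enorm_add_le _ _
          _ = _ := lintegral_add_left' ((Lp.aestronglyMeasurable _).mul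
                (Lp.aestronglyMeasurable _)).enorm _
          _ ≤ ‖b.1.pd i‖ₑ * ‖v.fn‖ₑ + ‖b.1.fn‖ₑ * ‖v.pd i‖ₑ :=
              add_le_add (lintegral_enorm_mul_le _ _) (lintegral_enorm_mul_le _ _)
          _ ≤ ‖b.1‖ₑ * ‖v‖ₑ + ‖b.1‖ₑ * ‖v‖ₑ := by
              gcongr
              · exact enorm_le_iff_norm_le.2 (b.1.norm_pd_le i)
              · exact enorm_le_iff_norm_le.2 v.norm_fn_le
              · exact enorm_le_iff_norm_le.2 b.1.norm_fn_le
              · exact enorm_le_iff_norm_le.2 (v.norm_pd_le i)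
          _ = _ := by ring
      · intro x hx
        by_contra hxΩ
        exact hx (by simp [hφ.eq_zero hxΩ, hφ.partialDeriv_eq_zero i hxΩ])
    rw [← ENNReal.pow_le_pow_left_iff two_ne_zero, sq_eLpNorm_two]
    calc ∫⁻ x in Ω, ‖b.1.fn x * v.fn x‖ₑ ^ 2 = ∫⁻ x in Ω, ‖b.1.fn x * φ x‖ₑ ^ 2 := by
          refine lintegral_congr_ae ?_
          filter_upwards [h0] with x hx
          rw [hx]
      _ ≤ ∫⁻ x, ‖b.1.fn x * φ x‖ₑ ^ 2 := setLIntegral_le_lintegral _ _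
      _ ≤ _ := hG
      _ ≤ (∑ _ : Fin 2, 2 * ‖b.1‖ₑ * ‖v‖ₑ) ^ 2 :=
          pow_le_pow_left₀ zero_le (Finset.sum_le_sum fun i _ => hi i) 2
      _ = _ := by rw [Fin.sum_univ_two]; ring
  · have hI : Integrable (fun x => b.1.fn x * φ x) (volume.restrict Ω) :=
      (Lp.memLp b.1.fn).integrable_mul hφ.memLp
    refine Integrable.locallyIntegrable ?_
    refine (integrableOn_iff_integrable_of_support_subset fun x hx => ?_).1 hI
    by_contra hxΩ
    exact hx (by simp [hφ.eq_zero hxΩ])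
  · exact ((hsm _).mul hφ.smooth.continuous.aestronglyMeasurable).add
      ((hsm _).mul (hφ.continuous_partialDeriv i).aestronglyMeasurable)

/-- `(w, g₁, g₂) ↦ w` as a continuous linear map. -/
def Jet.fnL (Ω : Set Plane) : Jet Ω →L[ℝ] L2 Ω := PiLp.proj 2 (fun _ : Fin 3 => L2 Ω) 0

/-- `(w, g₁, g₂) ↦ gᵢ` as a continuous linear map. -/
def Jet.pdL (Ω : Set Plane) (i : Fin 2) : Jet Ω →L[ℝ] L2 Ω :=
  PiLp.proj 2 (fun _ : Fin 3 => L2 Ω) i.succ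

theorem testJets_le_H10 : testJets Ω ≤ H10 Ω := Submodule.le_topologicalClosure _

instance completeSpace_H10 : CompleteSpace (H10 Ω) :=
  Submodule.topologicalClosure.completeSpace _

theorem H10.exists_seq (v : H10 Ω) :
    ∃ w : ℕ → H10 Ω, (∀ n, (w n).1 ∈ testJets Ω) ∧
      Filter.Tendsto w Filter.atTop (nhds v) := by
  obtain ⟨w, hw, hlim⟩ := mem_closure_iff_seq_limit.1
    (show v.1 ∈ closure (testJets Ω : Set (Jet Ω)) from v.2)
  exact ⟨fun n => ⟨w n, testJets_le_H10 (hw n)⟩, hw, tendsto_subtype_rng.2 hlim⟩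

/-- Closed properties of elements of `H¹₀(Ω)` can be checked on test functions. -/
theorem H10.induction {P : H10 Ω → Prop} (hP : IsClosed {v | P v})
    (h : ∀ v : H10 Ω, v.1 ∈ testJets Ω → P v) (v : H10 Ω) : P v := by
  obtain ⟨w, hw, hlim⟩ := H10.exists_seq v
  exact hP.mem_of_tendsto hlim (Filter.Eventually.of_forall fun n => h _ (hw n))

/-- Multiplication by a function in `H¹(Ω)` maps `H¹₀(Ω)` into `L²(Ω)`. -/
theorem eLpNorm_mul_le_of_mem_H10 (hΩ : IsOpen Ω) (b : H1 Ω) (v : H10 Ω) :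
    eLpNorm (fun x => b.1.fn x * v.1.fn x) 2 (volume.restrict Ω) ≤ 4 * ‖b.1‖ₑ * ‖v‖ₑ := by
  obtain ⟨w, hw, hlim⟩ := H10.exists_seq v
  have hlim' : Filter.Tendsto (fun n => (w n).1.fn) Filter.atTop (nhds v.1.fn) :=
    ((Jet.fnL Ω).continuous.comp continuous_subtype_val).continuousAt.tendsto.comp hlim
  -- A subsequence converges a.e., so the bound for test functions passes to the limit by lower
  -- semicontinuity of the `L²` norm.
  obtain ⟨ns, hns, hae⟩ := (tendstoInMeasure_of_tendsto_Lp hlim').exists_seq_tendsto_ae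
  refine (Lp.eLpNorm_lim_le_liminf_eLpNorm
    (f := fun n x => b.1.fn x * (w (ns n)).1.fn x) (fun n => ?_) _ ?_).trans ?_
  · exact (Lp.aestronglyMeasurable _).mul (Lp.aestronglyMeasurable _)
  · filter_upwards [hae] with x hx
    exact hx.const_mul _
  · have h1 : Filter.Tendsto (fun n => 4 * ‖b.1‖ₑ * ‖w (ns n)‖ₑ) Filter.atTop
        (nhds (4 * ‖b.1‖ₑ * ‖v‖ₑ)) := by
      refine ENNReal.Tendsto.const_mul (hlim.comp hns.tendsto_atTop).enorm (Or.inr ?_)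
      exact ENNReal.mul_ne_top (by simp) (by simp)
    rw [← h1.liminf_eq]
    exact Filter.liminf_le_liminf (Filter.Eventually.of_forall fun n =>
      eLpNorm_mul_le_of_mem_testJets hΩ b (hw (ns n)))

/-! ### Multiplication operators and the Gårding inequality -/

theorem inner_L2_eq_integral (f g : L2 Ω) : inner ℝ f g = ∫ x in Ω, f x * g x := by
  rw [L2.inner_def]
  exact integral_congr_ae (Filter.Eventually.of_forall fun x => by simp [mul_comm])

theorem integrable_mul_L2 (f g : L2 Ω) : Integrable (fun x => f x * g x) (volume.restrict Ω) :=
  (Lp.memLp f).integrable_mul (Lp.memLp g)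

/-- Multiplication by a measurable function as a bounded operator into `L²(Ω)`. -/
theorem exists_mulCLM {X : Type*} [NormedAddCommGroup X] [NormedSpace ℝ X] (L : X →L[ℝ] L2 Ω)
    {m : Plane → ℝ} (hm : AEStronglyMeasurable m (volume.restrict Ω)) (K : ℝ)
    (hK : ∀ x, eLpNorm (fun y => m y * L x y) 2 (volume.restrict Ω) ≤ ENNReal.ofReal K * ‖x‖ₑ) :
    ∃ M : X →L[ℝ] L2 Ω, ∀ x, M x =ᵐ[volume.restrict Ω] fun y => m y * L x y := by
  have hmem (x : X) : MemLp (fun y => m y * L x y) 2 (volume.restrict Ω) :=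
    ⟨hm.mul (Lp.aestronglyMeasurable _), (hK x).trans_lt (by finiteness)⟩
  let M₀ : X →ₗ[ℝ] L2 Ω :=
    { toFun := fun x => (hmem x).toLp
      map_add' := fun x x' => by
        refine Lp.ext ?_
        filter_upwards [(hmem (x + x')).coeFn_toLp, (hmem x).coeFn_toLp, (hmem x').coeFn_toLp,
          Lp.coeFn_add ((hmem x).toLp) ((hmem x').toLp), Lp.coeFn_add (L x) (L x')]
          with y h1 h2 h3 h4 h5
        rw [h1, h4, Pi.add_apply, h2, h3, map_add, h5, Pi.add_apply, mul_add]
      map_smul' := fun a x => by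
        refine Lp.ext ?_
        filter_upwards [(hmem (a • x)).coeFn_toLp, (hmem x).coeFn_toLp,
          Lp.coeFn_smul a ((hmem x).toLp), Lp.coeFn_smul a (L x)] with y h1 h2 h3 h4
        rw [h1, RingHom.id_apply, h3, Pi.smul_apply, h2, map_smul, h4, Pi.smul_apply, smul_eq_mul,
          smul_eq_mul]
        ring }
  refine ⟨M₀.mkContinuous (max K 0) fun x => ?_, fun x => (hmem x).coeFn_toLp⟩
  change ‖(hmem x).toLp‖ ≤ _
  rw [Lp.norm_toLp]
  refine ENNReal.toReal_le_of_le_ofReal (by positivity) ((hK x).trans_eq ?_)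
  rw [ENNReal.ofReal_mul (le_max_right _ _), ofReal_norm, ENNReal.ofReal_max, ENNReal.ofReal_zero,
    max_eq_left zero_le]

theorem exists_mulCLM_of_bounded {m : Plane → ℝ}
    (hm : AEStronglyMeasurable m (volume.restrict Ω)) {K : ℝ}
    (hK : ∀ᵐ x ∂(volume : Measure Plane).restrict Ω, 0 ≤ m x ∧ m x ≤ K) :
    ∃ M : L2 Ω →L[ℝ] L2 Ω, ∀ f, M f =ᵐ[volume.restrict Ω] fun y => m y * f y := by
  refine exists_mulCLM (ContinuousLinearMap.id ℝ (L2 Ω)) hm K fun f => ?_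
  rw [Lp.enorm_def]
  refine eLpNorm_le_mul_eLpNorm_of_ae_le_mul ?_ 2
  filter_upwards [hK] with x hx
  rw [norm_mul, Real.norm_of_nonneg hx.1]
  exact mul_le_mul_of_nonneg_right hx.2 (norm_nonneg _)

/-- Ladyzhenskaya's inequality for test functions. -/
theorem norm_sq_test_le {φ : Plane → ℝ} (hφ : IsTest Ω φ) {v : Jet Ω}
    (h0 : v.fn =ᵐ[volume.restrict Ω] φ)
    (h1 : ∀ i, v.pd i =ᵐ[volume.restrict Ω] partialDeriv i φ) :
    ‖(hφ.mul_smooth hφ.smooth).memLp.toLp‖ ≤ 2 * ‖v.fn‖ * ∑ i, ‖v.pd i‖ := by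
  have hφ2 := hφ.mul_smooth hφ.smooth
  have hi (i : Fin 2) : ∫⁻ x, ‖partialDeriv i (fun x => φ x * φ x) x‖ₑ
      ≤ 2 * (‖v.fn‖ₑ * ‖v.pd i‖ₑ) := by
    rw [← setLIntegral_eq_of_support_subset (s := Ω)]
    · refine le_trans (le_of_eq ?_) (mul_le_mul_right (lintegral_enorm_mul_le v.fn (v.pd i)) 2)
      rw [← lintegral_const_mul' _ _ (by simp)]
      refine lintegral_congr_ae ?_
      filter_upwards [h0, h1 i] with x hx hx'
      have hd := hφ.smooth.differentiable (by simp) x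
      rw [partialDeriv_mul i hd hd, hx, hx', ← two_mul, enorm_mul]
      congr 1
      rw [Real.enorm_of_nonneg zero_le_two, ENNReal.ofReal_ofNat]
    · intro x hx
      by_contra hxΩ
      exact hx (by simp [hφ2.partialDeriv_eq_zero i hxΩ])
  have hm (i) : Measurable fun x => ‖partialDeriv i (fun x => φ x * φ x) x‖ₑ :=
    (hφ2.continuous_partialDeriv i).enorm.measurable
  -- Gagliardo–Nirenberg for `φ²`, with `∂ᵢ(φ²) = 2 φ ∂ᵢφ` estimated by Cauchy–Schwarz.
  have key : eLpNorm (fun x => φ x * φ x) 2 (volume.restrict Ω)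
      ≤ ∑ i, 2 * (‖v.fn‖ₑ * ‖v.pd i‖ₑ) := by
    rw [← ENNReal.pow_le_pow_left_iff two_ne_zero, sq_eLpNorm_two]
    refine (setLIntegral_le_lintegral _ _).trans
      ((lintegral_sq_le_sq_lintegral_partialDeriv (hφ2.smooth.of_le (by simp)) hφ2.compact).trans ?_)
    rw [lintegral_finsetSum _ fun i _ => hm i]
    exact pow_le_pow_left₀ zero_le (Finset.sum_le_sum fun i _ => hi i) 2
  rw [Lp.norm_toLp]
  refine (ENNReal.toReal_mono (ENNReal.sum_ne_top.2 fun i _ => by finiteness) key).trans_eq ?_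
  rw [ENNReal.toReal_sum fun i _ => by finiteness, Finset.mul_sum]
  refine Finset.sum_congr rfl fun i _ => ?_
  simp [mul_assoc]

theorem sum_mul_sum_le (β s : Fin 2 → ℝ) :
    (∑ i, β i) * ∑ i, s i ≤ 2 * (√(∑ i, β i ^ 2) * √(∑ i, s i ^ 2)) := by
  have h (a : Fin 2 → ℝ) : |∑ i, a i| ≤ √2 * √(∑ i, a i ^ 2) := by
    rw [← Real.sqrt_mul zero_le_two]
    refine Real.abs_le_sqrt ?_
    simp only [Fin.sum_univ_two]
    nlinarith [sq_nonneg (a 0 - a 1)]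
  calc _ ≤ |∑ i, β i| * |∑ i, s i| := by rw [← abs_mul]; exact le_abs_self _
    _ ≤ (√2 * √(∑ i, β i ^ 2)) * (√2 * √(∑ i, s i ^ 2)) :=
        mul_le_mul (h β) (h s) (abs_nonneg _) (by positivity)
    _ = (√2 * √2) * (√(∑ i, β i ^ 2) * √(∑ i, s i ^ 2)) := by ring
    _ = _ := by rw [Real.mul_self_sqrt zero_le_two]

/-- For a test function, `∫ bᵢ v ∂ᵢv = -½ ∫ ∂ᵢbᵢ v²`, and Ladyzhenskaya's inequality bounds `‖v²‖`.
Both sides are continuous on `H¹₀(Ω)`, where `M i` is bounded, so density suffices. -/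
theorem abs_convection_le (b : Fin 2 → H1 Ω) (M : Fin 2 → H10 Ω →L[ℝ] L2 Ω)
    (hM : ∀ i v, M i v =ᵐ[volume.restrict Ω] fun x => (b i).1.fn x * v.1.fn x) (v : H10 Ω) :
    |∑ i, inner ℝ (M i v) (v.1.pd i)|
      ≤ 2 * √(∑ j, ‖(b j).1‖ ^ 2) * ‖v.1.fn‖ * √v.1.semiSq := by
  have hc0 : Continuous fun v : H10 Ω => v.1.fn := (Jet.fnL Ω).continuous.comp continuous_subtype_val
  have hc1 (i) : Continuous fun v : H10 Ω => v.1.pd i :=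
    (Jet.pdL Ω i).continuous.comp continuous_subtype_val
  refine H10.induction (P := fun v => |∑ i, inner ℝ (M i v) (v.1.pd i)|
      ≤ 2 * √(∑ j, ‖(b j).1‖ ^ 2) * ‖v.1.fn‖ * √v.1.semiSq) (isClosed_le ?_ ?_) ?_ v
  · fun_prop
  · unfold Jet.semiSq
    fun_prop
  clear v
  rintro v ⟨φ, hφ, h0, h1⟩
  have hφ2 := hφ.mul_smooth hφ.smooth
  set Φ : L2 Ω := hφ2.memLp.toLp with hΦ
  -- `φ²` is itself a test function for the weak derivative of `bᵢ`.
  have hi (i : Fin 2) : inner ℝ (M i v) (v.1.pd i) = -(1 / 2) * inner ℝ ((b i).1.pd i) Φ := by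
    have key := (b i).2 i _ hφ2
    have e1 : ∫ x in Ω, (b i).1.fn x * partialDeriv i (fun x => φ x * φ x) x
        = 2 * inner ℝ (M i v) (v.1.pd i) := by
      rw [inner_L2_eq_integral, ← integral_const_mul]
      refine integral_congr_ae ?_
      filter_upwards [h0, h1 i, hM i v] with x hx hx' hx''
      have hd := hφ.smooth.differentiable (by simp) x
      rw [partialDeriv_mul i hd hd, hx'', hx, hx']
      ring
    have e2 : inner ℝ ((b i).1.pd i) Φ = ∫ x in Ω, (b i).1.pd i x * (φ x * φ x) := by
      rw [inner_L2_eq_integral]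
      refine integral_congr_ae ?_
      filter_upwards [hφ2.memLp.coeFn_toLp] with x hx
      rw [hΦ, hx]
    rw [e1, ← e2] at key
    linarith
  have hΦle := norm_sq_test_le hφ h0 h1
  calc |∑ i, inner ℝ (M i v) (v.1.pd i)|
      ≤ ∑ i, |inner ℝ (M i v) (v.1.pd i)| := Finset.abs_sum_le_sum_abs _ _
    _ ≤ ∑ i, 1 / 2 * (‖(b i).1‖ * ‖Φ‖) := by
        refine Finset.sum_le_sum fun i _ => ?_
        rw [hi, abs_mul, abs_neg, abs_of_pos (by norm_num : (0 : ℝ) < 1 / 2)]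
        refine mul_le_mul_of_nonneg_left ((abs_real_inner_le_norm _ _).trans ?_) (by norm_num)
        exact mul_le_mul_of_nonneg_right ((b i).1.norm_pd_le i) (norm_nonneg _)
    _ = 1 / 2 * (∑ i, ‖(b i).1‖) * ‖Φ‖ := by rw [← Finset.mul_sum, ← Finset.sum_mul]; ring
    _ ≤ 1 / 2 * (∑ i, ‖(b i).1‖) * (2 * ‖v.1.fn‖ * ∑ i, ‖v.1.pd i‖) := by gcongr
    _ = ‖v.1.fn‖ * ((∑ i, ‖(b i).1‖) * ∑ i, ‖v.1.pd i‖) := by ring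
    _ ≤ ‖v.1.fn‖ * (2 * (√(∑ i, ‖(b i).1‖ ^ 2) * √(∑ i, ‖v.1.pd i‖ ^ 2))) := by
        exact mul_le_mul_of_nonneg_left (sum_mul_sum_le (fun i => ‖(b i).1‖) fun i => ‖v.1.pd i‖)
          (norm_nonneg _)
    _ = _ := by rw [Jet.semiSq]; ring

/-- The energy form is bounded on `H¹₀(Ω)` and satisfies a Gårding inequality. -/
theorem exists_energyForm_eq (hΩ : IsOpen Ω) {q : H1 Ω} (b : Fin 2 → H1 Ω) {c : LInf Ω}
    {q₀ q₁ c₁ : ℝ} (hq₀ : 0 < q₀)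
    (hq : ∀ᵐ x ∂(volume : Measure Plane).restrict Ω, q₀ ≤ q.1.fn x ∧ q.1.fn x ≤ q₁)
    (hc : ∀ᵐ x ∂(volume : Measure Plane).restrict Ω, 0 ≤ c x ∧ c x ≤ c₁) :
    ∃ A : H10 Ω → H10 Ω →L[ℝ] ℝ, (∀ v φ : H10 Ω, energyForm q b c v.1 φ.1 = A φ v) ∧
      ∀ v : H10 Ω, q₀ * v.1.semiSq
        - 2 * √(∑ j, ‖(b j).1‖ ^ 2) * ‖v.1.fn‖ * √v.1.semiSq ≤ A v v := by
  obtain ⟨Q, hQ⟩ := exists_mulCLM_of_bounded (Lp.aestronglyMeasurable q.1.fn)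
    (hq.mono fun x hx => ⟨hq₀.le.trans hx.1, hx.2⟩)
  obtain ⟨C, hC⟩ := exists_mulCLM_of_bounded (Lp.aestronglyMeasurable c) hc
  have hM' (i : Fin 2) := exists_mulCLM ((Jet.fnL Ω).comp (H10 Ω).subtypeL)
    (Lp.aestronglyMeasurable (b i).1.fn) (4 * ‖(b i).1‖) fun v => by
      refine (eLpNorm_mul_le_of_mem_H10 hΩ (b i) v).trans_eq ?_
      rw [ENNReal.ofReal_mul zero_le_four, ofReal_norm, ENNReal.ofReal_ofNat]
  choose M hM using hM'
  -- The test function comes first, so that `A φ` is a bounded functional of the solution and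
  -- commutes with time integrals.
  let A : H10 Ω → H10 Ω →L[ℝ] ℝ := fun φ =>
    (∑ i, (innerSL ℝ (φ.1.pd i)).comp (Q.comp ((Jet.pdL Ω i).comp (H10 Ω).subtypeL)))
      - (∑ i, (innerSL ℝ (φ.1.pd i)).comp (M i))
      + (innerSL ℝ φ.1.fn).comp (C.comp ((Jet.fnL Ω).comp (H10 Ω).subtypeL))
  have hA (φ v : H10 Ω) : A φ v = (∑ i, inner ℝ (Q (v.1.pd i)) (φ.1.pd i))
      - (∑ i, inner ℝ (M i v) (φ.1.pd i)) + inner ℝ (C v.1.fn) φ.1.fn := by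
    simp only [A, add_apply, sub_apply,
      sum_apply, ContinuousLinearMap.comp_apply, innerSL_apply_apply]
    simp only [real_inner_comm]
    rfl
  refine ⟨A, fun v φ => ?_, fun v => ?_⟩
  · rw [hA]
    simp only [inner_L2_eq_integral]
    have hI (F G : Fin 2 → L2 Ω) :
        Integrable (fun x => ∑ i, F i x * G i x) (volume.restrict Ω) :=
      integrable_finsetSum _ fun i _ => integrable_mul_L2 _ _
    have hI' (F G F' G' : Fin 2 → L2 Ω) : Integrable
        (fun x => ∑ i, F i x * G i x - ∑ i, F' i x * G' i x) (volume.restrict Ω) :=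
      (hI F G).sub (hI F' G')
    rw [← integral_finsetSum _ fun i _ => integrable_mul_L2 _ _,
      ← integral_finsetSum _ fun i _ => integrable_mul_L2 _ _,
      ← integral_sub (hI _ _) (hI _ _), ← integral_add (hI' _ _ _ _) (integrable_mul_L2 _ _)]
    refine integral_congr_ae ?_
    filter_upwards [ae_all_iff.2 fun i => hQ (v.1.pd i), ae_all_iff.2 fun i => hM i v,
      hC v.1.fn] with x h1 h2 h3
    simp only [h1, h2, h3]
    congr 2
    exact Finset.sum_congr rfl fun i _ => by
      rw [mul_comm (v.1.fn x)]; rfl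
  · rw [hA]
    have hq' (i : Fin 2) : q₀ * ‖v.1.pd i‖ ^ 2 ≤ inner ℝ (Q (v.1.pd i)) (v.1.pd i) := by
      rw [← real_inner_self_eq_norm_sq, inner_L2_eq_integral, inner_L2_eq_integral,
        ← integral_const_mul]
      refine integral_mono_ae ((integrable_mul_L2 _ _).const_mul _) (integrable_mul_L2 _ _) ?_
      filter_upwards [hQ (v.1.pd i), hq] with x hx hx'
      rw [hx, mul_assoc]
      exact mul_le_mul_of_nonneg_right hx'.1 (mul_self_nonneg _)
    have hc' : 0 ≤ inner ℝ (C v.1.fn) v.1.fn := by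
      rw [inner_L2_eq_integral]
      refine integral_nonneg_of_ae ?_
      filter_upwards [hC v.1.fn, hc] with x hx hx'
      rw [hx, mul_assoc]
      exact mul_nonneg hx'.1 (mul_self_nonneg _)
    have hb' := (abs_le.1 (abs_convection_le b M hM v)).2
    have hs : q₀ * v.1.semiSq ≤ ∑ i, inner ℝ (Q (v.1.pd i)) (v.1.pd i) := by
      rw [Jet.semiSq, Finset.mul_sum]
      exact Finset.sum_le_sum fun i _ => hq' i
    linarith

/-! ### Energy estimate for weak evolution equations -/

/-- A maximum principle for absorbing sets of dissipative differential inequalities. -/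
theorem norm_sq_le_max_of_dissipative {H : Type*} [NormedAddCommGroup H] [InnerProductSpace ℝ H]
    {x x' : ℝ → H} {s κ M : ℝ} (hκ : 0 < κ) (hs : 0 ≤ s) (hx : ∀ t, HasDerivAt x (x' t) t)
    (hd : ∀ t ∈ Icc 0 s, inner ℝ (x' t) (x t) ≤ -κ * (‖x t‖ ^ 2 - M)) :
    ‖x s‖ ^ 2 ≤ max (‖x 0‖ ^ 2) M := by
  -- Raising the barrier by `ε` makes the derivative strictly negative wherever the barrier is
  -- touched.
  refine le_of_forall_pos_le_add fun ε hε => ?_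
  have hy (t : ℝ) : HasDerivAt (fun t => ‖x t‖ ^ 2) (2 * inner ℝ (x t) (x' t)) t := (hx t).norm_sq
  refine image_le_of_deriv_right_lt_deriv_boundary (f := fun t => ‖x t‖ ^ 2)
    (f' := fun t => 2 * inner ℝ (x t) (x' t)) (a := 0) (b := s)
    (B := fun _ => max (‖x 0‖ ^ 2) M + ε) (B' := fun _ => 0)
    (fun t _ => (hy t).continuousAt.continuousWithinAt) (fun t _ => (hy t).hasDerivWithinAt)
    ?_ (fun t => hasDerivAt_const t _) (fun t ht he => ?_) (right_mem_Icc.2 hs)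
  · exact (le_max_left _ _).trans (le_add_of_nonneg_right hε.le)
  · have h1 := hd t (Ico_subset_Icc_self ht)
    have he' : ‖x t‖ ^ 2 = max (‖x 0‖ ^ 2) M + ε := he
    have h2 : M ≤ max (‖x 0‖ ^ 2) M := le_max_right _ _
    rw [real_inner_comm]
    have : 0 < κ * (‖x t‖ ^ 2 - M) := mul_pos hκ (by linarith)
    linarith

/-- The energy estimate for an autonomous evolution equation in weak form. It is applied to the
moving averages of the solution, which satisfy the same equation pointwise in time. -/
theorem norm_sq_le_of_weak_evolution {V H : Type*} [NormedAddCommGroup V] [NormedSpace ℝ V]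
    [CompleteSpace V] [NormedAddCommGroup H] [InnerProductSpace ℝ H] [CompleteSpace H]
    (j : V →L[ℝ] H) (A : V → V →L[ℝ] ℝ) (R : H →L[ℝ] H) (d : H) {κ M T : ℝ} (hκ : 0 < κ)
    (hM : 0 ≤ M) (hT : 0 < T)
    (hA : ∀ v, inner ℝ (d - R (j v)) (j v) - A v v ≤ -κ * (‖j v‖ ^ 2 - M))
    {w : ℝ → H} (hw : Continuous w) (hw0 : w 0 = 0) {W : ℝ → V}
    (hW : IntegrableOn W (Icc 0 T)) (hjW : ∀ᵐ t ∂volume.restrict (Icc 0 T), j (W t) = w t)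
    (hweak : ∀ φ, ∀ t ∈ Icc 0 T, inner ℝ (w t) (j φ) + ∫ s in (0 : ℝ)..t, A φ (W s)
      = ∫ s in (0 : ℝ)..t, inner ℝ (d - R (w s)) (j φ)) :
    ‖w T‖ ^ 2 ≤ M := by
  let P : ℝ → H := fun t => ∫ s in (0 : ℝ)..t, w s
  have hP (t : ℝ) : HasDerivAt P (w t) t :=
    intervalIntegral.integral_hasDerivAt_right (hw.intervalIntegrable _ _)
      (hw.stronglyMeasurableAtFilter _ _) hw.continuousAt
  have hWI {s t : ℝ} (hs : s ∈ Icc 0 T) (ht : t ∈ Icc 0 T) : IntervalIntegrable W volume s t :=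
    (hW.mono_set (uIcc_subset_Icc hs ht)).intervalIntegrable
  have key (h : ℝ) (hh : 0 < h) (hhT : h < T) :
      ‖h⁻¹ • (P (T - h + h) - P (T - h))‖ ^ 2 ≤ max (‖h⁻¹ • (P (0 + h) - P 0)‖ ^ 2) M := by
    refine norm_sq_le_max_of_dissipative (x := fun t => h⁻¹ • (P (t + h) - P t))
      (x' := fun t => h⁻¹ • (w (t + h) - w t)) hκ (sub_nonneg.2 hhT.le)
      (fun t => (((hP (t + h)).comp_add_const t h).sub (hP t)).const_smul _) fun t ht => ?_
    have ht0 : t ∈ Icc 0 T := ⟨ht.1, by linarith [ht.2]⟩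
    have ht1 : t + h ∈ Icc 0 T := ⟨by linarith [ht.1], by linarith [ht.2]⟩
    have h00 : (0 : ℝ) ∈ Icc 0 T := ⟨le_rfl, hT.le⟩
    -- The average of `W` lies in `V`, so it is an admissible test function, and `j X` is the
    -- average of `w`.
    let X : V := h⁻¹ • ∫ s in t..t + h, W s
    have hPsub : P (t + h) - P t = ∫ s in t..t + h, w s :=
      intervalIntegral.integral_interval_sub_left (hw.intervalIntegrable _ _)
        (hw.intervalIntegrable _ _)
    have hjX : j X = h⁻¹ • (P (t + h) - P t) := by
      rw [map_smul, ← j.intervalIntegral_comp_comm (hWI ht0 ht1), hPsub]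
      congr 1
      refine intervalIntegral.integral_congr_ae ?_
      have := (ae_restrict_iff' measurableSet_Icc).1 hjW
      filter_upwards [this] with s hs hst
      exact hs (uIcc_subset_Icc ht0 ht1 (uIoc_subset_uIcc hst))
    -- Subtracting the weak equations at `t + h` and `t` and pulling the time integrals through the
    -- bounded maps gives the equation for the average, tested with itself.
    have hdiff : inner ℝ (w (t + h) - w t) (j X)
        = h * (inner ℝ (d - R (j X)) (j X) - A X X) := by
      have e1 := hweak X _ ht1
      have e0 := hweak X _ ht0
      have hAI {s t : ℝ} (hs : s ∈ Icc 0 T) (ht : t ∈ Icc 0 T) :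
          IntervalIntegrable (fun s => A X (W s)) volume s t := 
        ⟨(A X).integrable_comp (hWI hs ht).1, (A X).integrable_comp (hWI hs ht).2⟩
      have hcont : Continuous fun s => d - R (w s) := by fun_prop
      have hcont' : Continuous fun s => inner ℝ (d - R (w s)) (j X) := by fun_prop
      have e2 := intervalIntegral.integral_interval_sub_left (hAI h00 ht1) (hAI h00 ht0)
      have e3 := intervalIntegral.integral_interval_sub_left (μ := volume)
        (hcont'.intervalIntegrable 0 (t + h)) (hcont'.intervalIntegrable 0 t)
      have e4 : ∫ s in t..t + h, A X (W s) = h * A X X := by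
        rw [(A X).intervalIntegral_comp_comm (hWI ht0 ht1), map_smul, smul_eq_mul,
          mul_inv_cancel_left₀ hh.ne']
      have e5 : ∫ s in t..t + h, inner ℝ (d - R (w s)) (j X)
          = h * inner ℝ (d - R (j X)) (j X) := by
        have h1 : ∫ s in t..t + h, (d - R (w s)) = h • (d - R (j X)) := by
          rw [intervalIntegral.integral_sub intervalIntegrable_const
            (Continuous.intervalIntegrable (by fun_prop) _ _),
            R.intervalIntegral_comp_comm (hw.intervalIntegrable _ _), hjX, hPsub, smul_sub,
            map_smul, smul_inv_smul₀ hh.ne', intervalIntegral.integral_const, add_sub_cancel_left]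
        have h2 := (innerSL ℝ (j X)).intervalIntegral_comp_comm (μ := volume)
          (hcont.intervalIntegrable t (t + h))
        simp only [innerSL_apply_apply] at h2
        simp only [real_inner_comm (j X)] at h2 ⊢
        rw [h2, h1, inner_smul_right]
      rw [inner_sub_left]
      linarith
    change inner ℝ (h⁻¹ • (w (t + h) - w t)) (h⁻¹ • (P (t + h) - P t))
      ≤ -κ * (‖h⁻¹ • (P (t + h) - P t)‖ ^ 2 - M)
    rw [← hjX, inner_smul_left, hdiff]
    refine le_trans (le_of_eq ?_) (hA X)
    rw [conj_trivial, inv_mul_cancel_left₀ hh.ne']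
  -- The last average, over `[T - h, T]`, is a left difference quotient of the primitive `P` at `T`.
  have hl : Filter.Tendsto (fun h : ℝ => h⁻¹ • (P (T - h + h) - P (T - h)))
      (nhdsWithin 0 (Ioi 0)) (nhds (w T)) := by
    have hneg : Filter.Tendsto (fun h : ℝ => -h) (nhdsWithin 0 (Ioi 0)) (nhdsWithin 0 (Iio 0)) := by
      simpa using tendsto_neg_nhdsGT (a := (0 : ℝ))
    refine ((hP T).tendsto_slope_zero_left.comp hneg).congr fun h => ?_
    simp only [Function.comp, inv_neg, neg_smul, ← sub_eq_add_neg, sub_add_cancel]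
    rw [← smul_neg, neg_sub]
  have hr : Filter.Tendsto (fun h : ℝ => h⁻¹ • (P (0 + h) - P 0))
      (nhdsWithin 0 (Ioi 0)) (nhds (w 0)) := (hP 0).tendsto_slope_zero_right
  have hlim := le_of_tendsto_of_tendsto (hl.norm.pow 2) ((hr.norm.pow 2).max (tendsto_const_nhds (x := M))) ?_
  · simpa [hw0, hM] using hlim
  · filter_upwards [Ioo_mem_nhdsGT hT] with h hh using key h hh.1 hh.2

/-! ### `H¹₀(Ω)` inside `H¹(Ω)`, mesh size and projection error -/

theorem IsTest.integral_mul_partialDeriv {φ ψ : Plane → ℝ} (hφ : IsTest Ω φ) (hψ : IsTest Ω ψ)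
    (i : Fin 2) :
    ∫ x in Ω, φ x * partialDeriv i ψ x = -∫ x in Ω, partialDeriv i φ x * ψ x := by
  rw [setIntegral_mul_test fun x hx => hψ.partialDeriv_eq_zero i hx,
    setIntegral_mul_test fun x hx => hψ.eq_zero hx]
  have hI {f g : Plane → ℝ} (hf : Continuous f) (hg : Continuous g) (hc : HasCompactSupport g) :
      Integrable fun x => f x * g x :=
    (hf.mul hg).integrable_of_hasCompactSupport hc.mul_left
  exact integral_mul_fderiv_eq_neg_fderiv_mul_of_integrable
    (hI (hφ.continuous_partialDeriv i) hψ.smooth.continuous hψ.compact)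
    (hI hφ.smooth.continuous (hψ.continuous_partialDeriv i) (hψ.hasCompactSupport_partialDeriv i))
    (hI hφ.smooth.continuous hψ.smooth.continuous hψ.compact)
    (fun x _ => hφ.smooth.differentiable (by simp) x)
    (fun x _ => hψ.smooth.differentiable (by simp) x)

theorem integral_mul_eq_inner_toLp (f : L2 Ω) {g : Plane → ℝ}
    (hg : MemLp g 2 (volume.restrict Ω)) : ∫ x in Ω, f x * g x = inner ℝ f hg.toLp := by
  rw [inner_L2_eq_integral]
  refine integral_congr_ae ?_
  filter_upwards [hg.coeFn_toLp] with x hx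
  rw [hx]

/-- `H¹₀(Ω) ⊆ H¹(Ω)`. -/
theorem H10.isWeakPartial (v : H10 Ω) (i : Fin 2) : IsWeakPartial i v.1.fn (v.1.pd i) := by
  intro ψ hψ
  have hc0 : Continuous fun v : H10 Ω => v.1.fn := (Jet.fnL Ω).continuous.comp continuous_subtype_val
  have hc1 : Continuous fun v : H10 Ω => v.1.pd i :=
    (Jet.pdL Ω i).continuous.comp continuous_subtype_val
  refine H10.induction (P := fun v => ∫ x in Ω, v.1.fn x * partialDeriv i ψ x
    = -∫ x in Ω, v.1.pd i x * ψ x) ?_ ?_ v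
  · simp only [integral_mul_eq_inner_toLp _ hψ.memLp,
      integral_mul_eq_inner_toLp _ (hψ.memLp_partialDeriv i)]
    exact isClosed_eq (by fun_prop) (by fun_prop)
  · rintro v ⟨φ, hφ, h0, h1⟩
    have e0 : ∫ x in Ω, v.1.fn x * partialDeriv i ψ x = ∫ x in Ω, φ x * partialDeriv i ψ x :=
      integral_congr_ae (by filter_upwards [h0] with x hx using by rw [hx])
    have e1 : ∫ x in Ω, v.1.pd i x * ψ x = ∫ x in Ω, partialDeriv i φ x * ψ x :=
      integral_congr_ae (by filter_upwards [h1 i] with x hx using by rw [hx])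
    rw [e0, e1, hφ.integral_mul_partialDeriv hψ]

/-- Excludes the degenerate product `∞ * 0 = 0` in the mesh condition, which therefore forces
`approxConst` to be finite. -/
theorem Subdivision.meshSize_pos (hΩ : Ω.Nonempty) (𝒯 : Subdivision Ω) : 0 < 𝒯.meshSize := by
  obtain ⟨x, hx⟩ := hΩ
  have hx' : x ∈ ⋃ T ∈ 𝒯.elements, T := 𝒯.cover ▸ subset_closure hx
  obtain ⟨T, hT, -⟩ := mem_iUnion₂.1 hx'
  refine lt_of_lt_of_le ?_ (Finset.le_sup hT)
  rw [Real.toNNReal_pos]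
  obtain ⟨s, hs⟩ := 𝒯.polygon T hT
  refine Metric.diam_pos ?_ ?_
  · exact ((infinite_of_mem_nhds _ (isOpen_interior.mem_nhds
      (𝒯.solid T hT).some_mem)).nontrivial).mono interior_subset
  · rw [hs]
    exact (s.finite_toSet.isCompact_convexHull (𝕜 := ℝ)).isBounded

theorem norm_projFE_sub_le (hΩ : Ω.Nonempty) {𝒯 : Subdivision Ω} {k : ℕ} {κ : ElementKind}
    {μ q₀ : ℝ} (hμ : 0 < μ) (hq₀ : 0 < q₀)
    (h : 2 * approxConst 𝒯 k κ ^ 2 * (𝒯.meshSize : ℝ≥0∞) ^ 2 * ENNReal.ofReal μ ^ 2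
      ≤ ENNReal.ofReal q₀) (w : H1 Ω) :
    2 * μ ^ 2 * ‖projFE 𝒯 k κ w.1.fn - w.1.fn‖ ^ 2 ≤ q₀ * w.1.semiSq := by
  have hm := 𝒯.meshSize_pos hΩ
  have ha : approxConst 𝒯 k κ ≠ ⊤ := by
    intro ha
    have h1 : (𝒯.meshSize : ℝ≥0∞) ^ 2 ≠ 0 := by simpa using hm.ne'
    have h2 : ENNReal.ofReal μ ^ 2 ≠ 0 := by simpa using hμ
    rw [ha, ENNReal.top_pow two_ne_zero, ENNReal.mul_top two_ne_zero, ENNReal.top_mul h1,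
      ENNReal.top_mul h2] at h
    exact ENNReal.ofReal_ne_top (top_le_iff.1 h)
  obtain ⟨a, ha⟩ : ∃ a : ℝ≥0, (a : ℝ≥0∞) = approxConst 𝒯 k κ := WithTop.ne_top_iff_exists.1 ha
  rw [← ha] at h
  have hle : ‖projFE 𝒯 k κ w.1.fn - w.1.fn‖ ≤ a * 𝒯.meshSize * √w.1.semiSq := by
    -- An infimum only yields admissible constants arbitrarily close above `a`; letting `ε → 0`
    -- shows that `a` itself is admissible.
    have hε (ε : ℝ≥0) (hε : 0 < ε) : ‖projFE 𝒯 k κ w.1.fn - w.1.fn‖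
        ≤ (a + ε : ℝ≥0) * 𝒯.meshSize * √w.1.semiSq := by
      have hlt : approxConst 𝒯 k κ < (a + ε : ℝ≥0) := by
        rw [← ha]
        exact_mod_cast lt_add_of_pos_right a hε
      obtain ⟨C, hC⟩ := iInf_lt_iff.1 hlt
      obtain ⟨hCw, hC⟩ := iInf_lt_iff.1 hC
      refine (hCw w).trans ?_
      gcongr
      exact_mod_cast hC.le
    have hlim : Filter.Tendsto
        (fun ε : ℝ≥0 => ((a + ε : ℝ≥0) : ℝ) * 𝒯.meshSize * √w.1.semiSq)
        (nhdsWithin 0 (Ioi 0)) (nhds (((a + 0 : ℝ≥0) : ℝ) * 𝒯.meshSize * √w.1.semiSq)) :=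
      (Continuous.tendsto (by fun_prop) 0).mono_left nhdsWithin_le_nhds
    rw [add_zero] at hlim
    exact ge_of_tendsto hlim (by filter_upwards [self_mem_nhdsWithin] with ε h using hε ε h)
  have hreal : 2 * (a : ℝ) ^ 2 * 𝒯.meshSize ^ 2 * μ ^ 2 ≤ q₀ := by
    have := ENNReal.toReal_mono ENNReal.ofReal_ne_top h
    simpa [ENNReal.toReal_ofReal hμ.le, ENNReal.toReal_ofReal hq₀.le] using this
  calc 2 * μ ^ 2 * ‖projFE 𝒯 k κ w.1.fn - w.1.fn‖ ^ 2
      ≤ 2 * μ ^ 2 * (a * 𝒯.meshSize * √w.1.semiSq) ^ 2 := by gcongr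
    _ = (2 * (a : ℝ) ^ 2 * 𝒯.meshSize ^ 2 * μ ^ 2) * √w.1.semiSq ^ 2 := by ring
    _ = (2 * (a : ℝ) ^ 2 * 𝒯.meshSize ^ 2 * μ ^ 2) * w.1.semiSq := by
        rw [Real.sq_sqrt w.1.semiSq_nonneg]
    _ ≤ _ := mul_le_mul_of_nonneg_right hreal w.1.semiSq_nonneg

/-! ### Absorption of the error terms -/

theorem two_add_le_of_ennreal {β q₀ μ : ℝ} {P Q R : ℝ≥0∞} (hβ : 0 ≤ β) (hq₀ : 0 < q₀)
    (hμ : 0 < μ)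
    (h : 2 + 4 * ((1 + P) ^ 2 * ENNReal.ofReal β + Q + R) / ENNReal.ofReal q₀
      ≤ ENNReal.ofReal μ) : 2 + 4 * β / q₀ ≤ μ := by
  rw [← ENNReal.ofReal_le_ofReal_iff hμ.le]
  refine le_trans ?_ h
  rw [ENNReal.ofReal_add zero_le_two (by positivity), ENNReal.ofReal_div_of_pos hq₀,
    ENNReal.ofReal_mul zero_le_four, ENNReal.ofReal_ofNat, ENNReal.ofReal_ofNat]
  gcongr
  calc ENNReal.ofReal β = 1 ^ 2 * ENNReal.ofReal β := by rw [one_pow, one_mul]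
    _ ≤ (1 + P) ^ 2 * ENNReal.ofReal β := by gcongr; exact le_self_add
    _ ≤ _ := by rw [add_assoc]; exact le_self_add

/-- Of the diffusion `q₀ S`, a quarter pays for the projection error and a half for convection. Of
the nudging `μ n²`, a half pays for convection and a quarter for the source; `-(μ/4) n²` is left. -/
theorem dissipation_arith {q₀ μ β S n a e g α : ℝ} (hq₀ : 0 < q₀) (hβ : 0 ≤ β) (hS : 0 ≤ S)
    (hμ : 2 + 4 * β / q₀ ≤ μ) (ha : 2 * μ ^ 2 * a ≤ q₀ * S) (hg : g ≤ e * n)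
    (hα : q₀ * S - 2 * √β * n * √S ≤ α) :
    g - μ * (n ^ 2 - a) - α ≤ -(μ / 4) * (n ^ 2 - 4 * e ^ 2 / μ ^ 2) := by
  have hμ2 : 2 ≤ μ := le_trans (le_add_of_nonneg_right (by positivity)) hμ
  have hμ0 : 0 < μ := by linarith
  -- Uses `μ ≥ 2`: `4 μ² a ≤ 2 q₀ S ≤ μ q₀ S`.
  have h1 : μ * a ≤ q₀ * S / 4 := by
    have : μ * (4 * (μ * a)) ≤ μ * (q₀ * S) := by
      nlinarith [mul_nonneg hq₀.le hS]
    linarith [le_of_mul_le_mul_left this hμ0]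
  have h2 : 2 * √β * n * √S ≤ q₀ / 2 * S + μ / 2 * n ^ 2 := by
    have h3 : β / q₀ ≤ μ / 4 := by
      have : 4 * (β / q₀) ≤ μ := by rw [← mul_div_assoc]; linarith
      linarith
    have h4 : 2 * √β * n * √S ≤ q₀ / 2 * S + 2 * (β / q₀) * n ^ 2 := by
      have h5 : 0 ≤ (q₀ * √S - 2 * √β * n) ^ 2 / (2 * q₀) := by positivity
      have h6 : (q₀ * √S - 2 * √β * n) ^ 2 / (2 * q₀)
          = q₀ / 2 * √S ^ 2 - 2 * √β * n * √S + 2 * (√β ^ 2 / q₀) * n ^ 2 := by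
        field_simp
        ring
      rw [h6, Real.sq_sqrt hS, Real.sq_sqrt hβ] at h5
      linarith
    nlinarith [mul_le_mul_of_nonneg_right h3 (sq_nonneg n)]
  have h7 : e * n ≤ μ / 4 * n ^ 2 + e ^ 2 / μ := by
    have h5 : 0 ≤ (μ * n - 2 * e) ^ 2 / (4 * μ) := by positivity
    have h6 : (μ * n - 2 * e) ^ 2 / (4 * μ) = μ / 4 * n ^ 2 - e * n + e ^ 2 / μ := by
      field_simp
      ring
    linarith
  have h8 : -(μ / 4) * (n ^ 2 - 4 * e ^ 2 / μ ^ 2) = -(μ / 4) * n ^ 2 + e ^ 2 / μ := by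
    field_simp
    ring
  rw [h8]
  nlinarith [mul_nonneg hq₀.le hS]

/-- Pythagoras: `I_h f` is orthogonal to `f - I_h f`. -/
theorem inner_projFE_self (𝒯 : Subdivision Ω) (k : ℕ) (κ : ElementKind) (f : L2 Ω) :
    inner ℝ (projFE 𝒯 k κ f) f = ‖f‖ ^ 2 - ‖projFE 𝒯 k κ f - f‖ ^ 2 := by
  have h : inner ℝ (projFE 𝒯 k κ f) (f - projFE 𝒯 k κ f) = 0 :=
    Submodule.inner_right_of_mem_orthogonal ((feSpace 𝒯 k κ).starProjection_apply_mem f)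
      ((feSpace 𝒯 k κ).sub_starProjection_mem_orthogonal f)
  rw [inner_sub_right, real_inner_self_eq_norm_sq] at h
  rw [norm_sub_sq_real]
  linarith

theorem norm_projFE_le (𝒯 : Subdivision Ω) (k : ℕ) (κ : ElementKind) (f : L2 Ω) :
    ‖projFE 𝒯 k κ f‖ ≤ ‖f‖ := (feSpace 𝒯 k κ).norm_starProjection_apply_le f

/-! ### Stability of the assimilated solution and conclusion -/

/-- The difference of two solutions of the data assimilation equation. -/
theorem norm_sub_le_of_isAssimilated (hΩ : IsOpen Ω) {q₀ q₁ c₁ : ℝ}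
    (hq₀ : 0 < q₀) {q : H1 Ω} {b : Fin 2 → H1 Ω} {c : LInf Ω} {𝒯 : Subdivision Ω} {k : ℕ}
    {κ : ElementKind} {μ T : ℝ}
    (hq : ∀ᵐ x ∂(volume : Measure Plane).restrict Ω, q₀ ≤ q.1.fn x ∧ q.1.fn x ≤ q₁)
    (hc : ∀ᵐ x ∂(volume : Measure Plane).restrict Ω, 0 ≤ c x ∧ c x ≤ c₁)
    (hμ : 0 < μ) (hT : 0 < T) (hμb : 2 + 4 * (∑ j, ‖(b j).1‖ ^ 2) / q₀ ≤ μ)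
    (happrox : ∀ w : H1 Ω,
      2 * μ ^ 2 * ‖projFE 𝒯 k κ w.1.fn - w.1.fn‖ ^ 2 ≤ q₀ * w.1.semiSq)
    {u : ℝ → L2 Ω} (hu : ContinuousOn u (Icc 0 T)) {f₁ f₂ : L2 Ω} {v₁ v₂ : ℝ → L2 Ω}
    (h₁ : IsAssimilated T q b c 𝒯 k κ μ u f₁ v₁) (h₂ : IsAssimilated T q b c 𝒯 k κ μ u f₂ v₂) :
    ‖v₁ T - v₂ T‖ ≤ 2 * ‖f₁ - f₂‖ / μ := by
  obtain ⟨A, hA, hcoer⟩ := exists_energyForm_eq hΩ b hq₀ hq hc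
  obtain ⟨V₁, hV₁, hv₁, hw₁⟩ := h₁.weak
  obtain ⟨V₂, hV₂, hv₂, hw₂⟩ := h₂.weak
  let j : H10 Ω →L[ℝ] L2 Ω := (Jet.fnL Ω).comp (H10 Ω).subtypeL
  have hj (v : H10 Ω) : j v = v.1.fn := rfl
  let R : L2 Ω →L[ℝ] L2 Ω := μ • projFE 𝒯 k κ
  -- Constant extension beyond `[0, T]` makes the difference continuous on all of `ℝ`.
  let w : ℝ → L2 Ω := IccExtend hT.le ((Icc 0 T).domRestrict fun t => v₁ t - v₂ t)
  have hwI {t : ℝ} (ht : t ∈ Icc 0 T) : w t = v₁ t - v₂ t := IccExtend_of_mem _ _ ht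
  have hw : Continuous w :=
    (continuousOn_iff_continuous_domRestrict.1 (h₁.continuousOn.sub h₂.continuousOn)).Icc_extend'
  have hI₁ : IntegrableOn V₁ (Icc 0 T) := hV₁.integrable one_le_two
  have hI₂ : IntegrableOn V₂ (Icc 0 T) := hV₂.integrable one_le_two
  have h0T : (0 : ℝ) ∈ Icc 0 T := ⟨le_rfl, hT.le⟩
  have key := norm_sq_le_of_weak_evolution j A R (f₁ - f₂) (κ := μ / 4)
    (M := 4 * ‖f₁ - f₂‖ ^ 2 / μ ^ 2) (by positivity) (by positivity) hT (fun v => ?_) hw ?_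
    (W := fun t => V₁ t - V₂ t) (hI₁.sub hI₂) ?_ fun φ t ht => ?_
  · rw [hwI ⟨hT.le, le_rfl⟩] at key
    refine le_of_sq_le_sq (key.trans_eq ?_) (by positivity)
    rw [div_pow, mul_pow]
    norm_num
  · have hR : inner ℝ (R (j v)) (j v)
        = μ * (‖v.1.fn‖ ^ 2 - ‖projFE 𝒯 k κ v.1.fn - v.1.fn‖ ^ 2) := by
      rw [← inner_projFE_self, ← real_inner_smul_left]
      rfl
    rw [inner_sub_left, hR]
    exact dissipation_arith hq₀ (Finset.sum_nonneg fun _ _ => sq_nonneg _) v.1.semiSq_nonneg hμb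
      (happrox ⟨v.1, H10.isWeakPartial v⟩) (real_inner_le_norm _ _) (hcoer v)
  · rw [hwI h0T, h₁.initial, h₂.initial, sub_zero]
  · filter_upwards [hv₁, hv₂, ae_restrict_mem measurableSet_Icc] with t e₁ e₂ ht
    rw [map_sub, hj, hj, e₁, e₂, hwI ht]
  · have hsub : uIcc 0 t ⊆ Icc 0 T := uIcc_subset_Icc h0T ht
    have hAI {V : ℝ → H10 Ω} (hV : IntegrableOn V (Icc 0 T)) :
        IntervalIntegrable (fun s => A φ (V s)) volume 0 t := by
      have := (hV.mono_set hsub).intervalIntegrable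
      exact ⟨(A φ).integrable_comp this.1, (A φ).integrable_comp this.2⟩
    have hFI {f : L2 Ω} {v : ℝ → L2 Ω} (hv : ContinuousOn v (Icc 0 T)) : IntervalIntegrable
        (fun s => inner ℝ (f + μ • projFE 𝒯 k κ (u s - v s)) φ.1.fn) volume 0 t := by
      refine ContinuousOn.intervalIntegrable ?_
      have h := (hu.sub hv).mono hsub
      exact (continuousOn_const.add (((projFE 𝒯 k κ).continuous.comp_continuousOn h).const_smul
        μ)).inner continuousOn_const
    have e₁ := hw₁ φ t ht
    have e₂ := hw₂ φ t ht
    simp only [hA, inner_zero_left, sub_zero] at e₁ e₂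
    rw [hwI ht, inner_sub_left]
    simp only [map_sub (A φ)]
    rw [intervalIntegral.integral_sub (hAI hI₁) (hAI hI₂)]
    -- The reference solution `u` cancels, leaving an autonomous source.
    have e₃ : ∫ s in (0 : ℝ)..t, inner ℝ (f₁ - f₂ - R (w s)) (j φ)
        = (∫ s in (0 : ℝ)..t, inner ℝ (f₁ + μ • projFE 𝒯 k κ (u s - v₁ s)) φ.1.fn)
          - ∫ s in (0 : ℝ)..t, inner ℝ (f₂ + μ • projFE 𝒯 k κ (u s - v₂ s)) φ.1.fn := by
      rw [← intervalIntegral.integral_sub (hFI h₁.continuousOn) (hFI h₂.continuousOn)]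
      refine intervalIntegral.integral_congr fun s hs => ?_
      change inner ℝ (f₁ - f₂ - μ • projFE 𝒯 k κ (w s)) φ.1.fn = _
      rw [hwI (hsub hs), ← inner_sub_left]
      congr 1
      simp only [map_sub, smul_sub]
      abel
    rw [e₃, ← e₁, ← e₂, hj]
    ring

end

theorem mainTheorem10 (Ω : Set Plane) (hΩ : IsConvexPolygon Ω) (q₀ : ℝ) (hq₀ : 0 < q₀) :
    ∃ C : ℝ, 0 < C ∧
      ∀ (q₁ c₁ : ℝ) (q : H1 Ω) (b : Fin 2 → H1 Ω) (c : LInf Ω) (f u₀ : L2 Ω)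
        (𝒯 : Subdivision Ω) (k : ℕ) (κ : ElementKind) (μ T : ℝ),
        (∀ᵐ x ∂(volume : Measure Plane).restrict Ω, q₀ ≤ q.1.fn x ∧ q.1.fn x ≤ q₁) →
        (∀ᵐ x ∂(volume : Measure Plane).restrict Ω, 0 ≤ c x ∧ c x ≤ c₁) →
        0 < μ → 0 < T →
        2 + 4 * ((1 + poincareConst Ω) ^ 2 * ENNReal.ofReal (∑ j, ‖(b j).1‖ ^ 2)
            + 2 * ENNReal.ofReal c₁ * poincareConst Ω + ENNReal.ofReal q.1.semiSq)
              / ENNReal.ofReal q₀ ≤ ENNReal.ofReal μ →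
        2 * approxConst 𝒯 k κ ^ 2 * (𝒯.meshSize : ℝ≥0∞) ^ 2 * ENNReal.ofReal μ ^ 2
            ≤ ENNReal.ofReal q₀ →
        ∀ u : ℝ → L2 Ω, IsWeakSolution T q b c (fun _ => f) u₀ u →
        ∀ (f₁ f₂ : L2 Ω) (v₁ v₂ : ℝ → L2 Ω),
          IsAssimilated T q b c 𝒯 k κ μ u f₁ v₁ →
          IsAssimilated T q b c 𝒯 k κ μ u f₂ v₂ →
          ‖approxGradF 𝒯 k κ μ T u v₁ - approxGradF 𝒯 k κ μ T u v₂‖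
            ≤ C / μ ^ (3 / 2 : ℝ) * ‖f₁ - f₂‖ := by
  refine ⟨2, two_pos, fun q₁ c₁ q b c f u₀ 𝒯 k κ μ T hq hc hμ hT hμb hh u hu f₁ f₂ v₁ v₂ h₁ h₂ => ?_⟩
  have hopen : IsOpen Ω := by
    obtain ⟨-, s, rfl⟩ := hΩ
    exact isOpen_interior
  have hβ : 0 ≤ ∑ j, ‖(b j).1‖ ^ 2 := Finset.sum_nonneg fun _ _ => sq_nonneg _
  have hμb' := two_add_le_of_ennreal hβ hq₀ hμ hμb
  have hμ1 : 1 ≤ μ := by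
    have : 0 ≤ 4 * (∑ j, ‖(b j).1‖ ^ 2) / q₀ := by positivity
    linarith
  have key := norm_sub_le_of_isAssimilated hopen hq₀ hq hc hμ hT hμb'
    (norm_projFE_sub_le hΩ.1 hμ hq₀ hh) hu.continuousOn h₁ h₂
  have hdiff : approxGradF 𝒯 k κ μ T u v₁ - approxGradF 𝒯 k κ μ T u v₂
      = (1 / μ) • projFE 𝒯 k κ (v₁ T - v₂ T) := by
    simp only [approxGradF, map_sub, smul_sub]
    abel
  have hpow : μ ^ (3 / 2 : ℝ) ≤ μ ^ 2 := by
    rw [← Real.rpow_natCast]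
    exact Real.rpow_le_rpow_of_exponent_le hμ1 (by norm_num)
  rw [hdiff, norm_smul, Real.norm_of_nonneg (by positivity)]
  calc 1 / μ * ‖projFE 𝒯 k κ (v₁ T - v₂ T)‖ ≤ 1 / μ * (2 * ‖f₁ - f₂‖ / μ) := by
        gcongr
        exact (norm_projFE_le _ _ _ _).trans key
    _ = 2 / μ ^ 2 * ‖f₁ - f₂‖ := by field_simp
    _ ≤ 2 / μ ^ (3 / 2 : ℝ) * ‖f₁ - f₂‖ := by gcongr
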